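/- Let $\Gamma$ be a discrete group with a measure preserving action on a probability space $(X,\mu)$, let $\pi\colon\Gamma\to O(H)$ be an orthogonal representation on a separable real Hilbert space $H$, and let $b\colon\Gamma\to H$ be a 1-cocycle, i.e. $b(gh)=\pi(g)b(h)+b(g)$ for all $g,h\in\Gamma$. Put $A=L^\infty(X,\mu)$. Fix an orthonormal basis $(e_n)_n$ of $H$, let $(Z,\nu)=\prod_n\big(\mathbb R,\tfrac1{\sqrt{2\pi}}e^{-x^2/2}dx\big)$, and for $\xi=\sum_n c_ne_n\in H$ let $\omega(\xi)\in L^\infty(Z,\nu)$ be the unitary $\omega(\xi)(z)=\exp\big(\sqrt2\,i\sum_n c_nz_n\big)$, where the sum converges in $L^2(Z,\nu)$. Let $D=\{\omega(\xi):\xi\in H\}''\subseteq L^\infty(Z,\nu)$, with the Gaussian action of $\Gamma$, determined by $g\cdot\omega(\xi)=\omega(\pi(g)\xi)$. Let $\tilde M=(D\bar\otimes A)\rtimes\Gamma$ be the von Neumann algebraic crossed product by the diagonal action, with canonical unitaries $u_g$ ($g\in\Gamma$), canonical trace $\tau\big(\sum_g x_gu_g\big)=\int x_e\,d(\nu\times\mu)$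 and 2-norm $\|x\|_2=\tau(x^*x)^{1/2}$. Then for every $t\in\mathbb R$ there is a unique normal $*$-endomorphism $\alpha_t$ of $\tilde M$ with $$\alpha_t|_{D\bar\otimes A}=\operatorname{id}\quad\text{and}\quad \alpha_t(u_g)=(\omega(tb(g))\otimes1)u_g\ \text{ for all } g\in\Gamma .$$ Each $\alpha_t$ is a $*$-automorphism of $\tilde M$, and $(\alpha_t)_{t\in\mathbb R}$ is a one-parameter group: $\alpha_0=\operatorname{id}$ and $\alpha_{s+t}=\alpha_s\alpha_t$ for all $s,t\in\mathbb R$. Moreover $\lim_{t\to0}\|\alpha_t(x)-x\|_2=0$ for every $x\in\tilde M$. -/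

import Mathlib

open MeasureTheory ProbabilityTheory Filter Topology
open scoped ENNReal TensorProduct InnerProductSpace

noncomputable section

namespace CocycleDeformation

/-! ### Von Neumann algebras -/

section Hilbert

variable {K : Type*} [NormedAddCommGroup K] [InnerProductSpace ℂ K] [CompleteSpace K]

/-- The von Neumann algebra `(S ∪ S*)''` generated by a set `S` of bounded operators. -/
def vonNeumannClosure (S : Set (K →L[ℂ] K)) : VonNeumannAlgebra K where
  toStarSubalgebra := StarSubalgebra.centralizer ℂ (StarSubalgebra.centralizer ℂ S : Set (K →L[ℂ] K))
  centralizer_centralizer' := by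
    change Set.centralizer (Set.centralizer (StarSubalgebra.centralizer ℂ
      (StarSubalgebra.centralizer ℂ S : Set (K →L[ℂ] K)) : Set (K →L[ℂ] K))) =
      (StarSubalgebra.centralizer ℂ
      (StarSubalgebra.centralizer ℂ S : Set (K →L[ℂ] K)) : Set (K →L[ℂ] K))
    rw [StarSubalgebra.coe_centralizer_centralizer, Set.centralizer_centralizer_centralizer]

theorem subset_vonNeumannClosure (S : Set (K →L[ℂ] K)) :
    S ⊆ (vonNeumannClosure S).toStarSubalgebra :=
  fun _ hx => StarAlgebra.adjoin_le_centralizer_centralizer ℂ S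
    (StarAlgebra.subset_adjoin ℂ S hx)

end Hilbert

section Normal

variable {K : Type*} [NormedAddCommGroup K] [InnerProductSpace ℂ K] [CompleteSpace K]

/-- The ultraweakly continuous (normal) functionals `x ↦ ∑ₙ ⟪ξₙ, x ηₙ⟫`, with
`∑ₙ ‖ξₙ‖² < ∞` and `∑ₙ ‖ηₙ‖² < ∞`, on a von Neumann algebra. -/
def IsNormalFunctional (M : VonNeumannAlgebra K) (φ : M.toStarSubalgebra → ℂ) : Prop :=
  ∃ ξ η : lp (fun _ : ℕ => K) 2, ∀ x : M.toStarSubalgebra,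
    φ x = ∑' n, ⟪ξ n, (x : K →L[ℂ] K) (η n)⟫_ℂ

/-- A linear map from a von Neumann algebra to itself is normal (ultraweakly continuous) if composition
with it preserves normal functionals. -/
def IsNormalMap (M : VonNeumannAlgebra K) (β : M.toStarSubalgebra → M.toStarSubalgebra) : Prop :=
  ∀ φ : M.toStarSubalgebra → ℂ, IsNormalFunctional M φ → IsNormalFunctional M (fun x => φ (β x))

end Normal

/-! ### Tensor products -/

section Tensor

variable (E F : Type*) [NormedAddCommGroup E] [InnerProductSpace ℂ E]
  [NormedAddCommGroup F] [InnerProductSpace ℂ F]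

/-- The Hilbert space tensor product. -/
abbrev HilbertTensor : Type _ := UniformSpace.Completion (E ⊗[ℂ] F)

variable {E F}

theorem exists_orthonormal_sum (v : E ⊗[ℂ] F) : ∃ (n : ℕ) (u : Fin n → E) (f : Fin n → F),
    Orthonormal ℂ f ∧ v = ∑ j, u j ⊗ₜ[ℂ] f j := by
  obtain ⟨E', F', iE', iF', hz⟩ :=
    TensorProduct.exists_finite_submodule_of_setFinite {v} (Set.finite_singleton v)
  obtain ⟨y, hy⟩ := Set.singleton_subset_iff.mp hz
  let f := stdOrthonormalBasis ℂ F'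
  have key : ∀ y : E' ⊗[ℂ] F', ∃ u : Fin (Module.finrank ℂ F') → E,
      TensorProduct.mapIncl E' F' y = ∑ j, u j ⊗ₜ[ℂ] (f j : F) := by
    intro y
    induction y using TensorProduct.induction_on with
    | zero => exact ⟨0, by simp⟩
    | tmul a b =>
      refine ⟨fun j => ⟪f j, b⟫_ℂ • (a : E), ?_⟩
      simp only [TensorProduct.mapIncl, TensorProduct.map_tmul, Submodule.subtype_apply,
        TensorProduct.smul_tmul, ← TensorProduct.tmul_sum]
      congr 1
      conv_lhs => rw [← f.sum_repr' b]
      simp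
    | add a b ha hb =>
      obtain ⟨u, hu⟩ := ha
      obtain ⟨w, hw⟩ := hb
      exact ⟨u + w, by simp [map_add, hu, hw, TensorProduct.add_tmul, Finset.sum_add_distrib]⟩
  obtain ⟨u, hu⟩ := key y
  exact ⟨_, u, fun j => (f j : F), f.orthonormal.comp_linearIsometry F'.subtypeₗᵢ, hy ▸ hu⟩

theorem norm_sq_sum_tmul {n : ℕ} (u : Fin n → E) {f : Fin n → F} (hf : Orthonormal ℂ f) :
    ‖∑ j, u j ⊗ₜ[ℂ] f j‖ ^ 2 = ∑ j, ‖u j‖ ^ 2 := by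
  have : (‖∑ j, u j ⊗ₜ[ℂ] f j‖ ^ 2 : ℂ) = ∑ j, (‖u j‖ ^ 2 : ℂ) := by
    have h := inner_self_eq_norm_sq_to_K (𝕜 := ℂ) (∑ j, u j ⊗ₜ[ℂ] f j)
    simp only [Complex.coe_algebraMap] at h
    rw [← h]
    simp only [sum_inner, inner_sum, TensorProduct.inner_tmul]
    simp_rw [orthonormal_iff_ite.mp hf]
    simp [inner_self_eq_norm_sq_to_K]
  exact_mod_cast this

theorem norm_map_id_le (S : E →L[ℂ] E) (v : E ⊗[ℂ] F) :
    ‖TensorProduct.map (S : E →ₗ[ℂ] E) (LinearMap.id : F →ₗ[ℂ] F) v‖ ≤ ‖S‖ * ‖v‖ := by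
  obtain ⟨n, u, f, hf, rfl⟩ := exists_orthonormal_sum v
  refine le_of_sq_le_sq ?_ (by positivity)
  rw [mul_pow, norm_sq_sum_tmul u hf, map_sum]
  simp only [TensorProduct.map_tmul, LinearMap.id_apply]
  rw [norm_sq_sum_tmul _ hf, Finset.mul_sum]
  refine Finset.sum_le_sum fun j _ => ?_
  rw [← mul_pow]
  exact pow_le_pow_left₀ (norm_nonneg _) (S.le_opNorm _) 2

theorem norm_map_le (S : E →L[ℂ] E) (T : F →L[ℂ] F) (v : E ⊗[ℂ] F) :
    ‖TensorProduct.map (S : E →ₗ[ℂ] E) (T : F →ₗ[ℂ] F) v‖ ≤ ‖S‖ * ‖T‖ * ‖v‖ := by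
  have h1 : TensorProduct.map (S : E →ₗ[ℂ] E) (T : F →ₗ[ℂ] F) v =
      TensorProduct.map (S : E →ₗ[ℂ] E) LinearMap.id
        (TensorProduct.comm ℂ F E (TensorProduct.map (T : F →ₗ[ℂ] F) LinearMap.id
          (TensorProduct.comm ℂ E F v))) := by
    induction v using TensorProduct.induction_on with
    | zero => simp
    | tmul a b => simp
    | add a b ha hb => simp only [map_add, ha, hb]
  rw [h1, mul_assoc]
  refine (norm_map_id_le S _).trans (mul_le_mul_of_nonneg_left ?_ (norm_nonneg _))
  rw [TensorProduct.norm_comm]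
  refine (norm_map_id_le T _).trans ?_
  rw [TensorProduct.norm_comm]

/-- The bounded operator `S ⊗ T` on the Hilbert space tensor product. -/
def opTensor (S : E →L[ℂ] E) (T : F →L[ℂ] F) : HilbertTensor E F →L[ℂ] HilbertTensor E F :=
  ((TensorProduct.map (S : E →ₗ[ℂ] E) (T : F →ₗ[ℂ] F)).mkContinuous (‖S‖ * ‖T‖)
    (norm_map_le S T)).completion

theorem opTensor_tmul (S : E →L[ℂ] E) (T : F →L[ℂ] F) (x : E) (y : F) :
    opTensor S T ((x ⊗ₜ[ℂ] y : E ⊗[ℂ] F) : HilbertTensor E F) =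
      ((S x ⊗ₜ[ℂ] T y : E ⊗[ℂ] F) : HilbertTensor E F) := by
  rw [opTensor, ContinuousLinearMap.completion_apply_coe]
  rfl

theorem hilbertTensor_ext {G : Type*} [NormedAddCommGroup G] [NormedSpace ℂ G]
    {A B : HilbertTensor E F →L[ℂ] G}
    (h : ∀ (x : E) (y : F), A ((x ⊗ₜ[ℂ] y : E ⊗[ℂ] F) : HilbertTensor E F) =
      B ((x ⊗ₜ[ℂ] y : E ⊗[ℂ] F) : HilbertTensor E F)) : A = B := by
  ext v
  induction v using UniformSpace.Completion.induction_on with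
  | hp => exact isClosed_eq A.continuous B.continuous
  | ih v =>
    induction v using TensorProduct.induction_on with
    | zero => rw [UniformSpace.Completion.coe_zero, map_zero, map_zero]
    | tmul a b => exact h a b
    | add a b ha hb => rw [UniformSpace.Completion.coe_add, map_add, map_add, ha, hb]

theorem opTensor_mul (S S' : E →L[ℂ] E) (T T' : F →L[ℂ] F) :
    opTensor (S * S') (T * T') = opTensor S T * opTensor S' T' :=
  hilbertTensor_ext fun x y => by simp [opTensor_tmul]

theorem opTensor_one : opTensor (1 : E →L[ℂ] E) (1 : F →L[ℂ] F) = 1 :=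
  hilbertTensor_ext fun x y => by simp [opTensor_tmul]

variable [CompleteSpace E] [CompleteSpace F]

theorem opTensor_star (S : E →L[ℂ] E) (T : F →L[ℂ] F) :
    star (opTensor S T) = opTensor (star S) (star T) := by
  rw [ContinuousLinearMap.star_eq_adjoint]
  symm
  rw [ContinuousLinearMap.eq_adjoint_iff]
  intro v w
  induction v, w using UniformSpace.Completion.induction_on₂ with
  | hp => exact isClosed_eq (by fun_prop) (by fun_prop)
  | ih v w =>
    induction v using TensorProduct.induction_on with
    | zero => rw [UniformSpace.Completion.coe_zero, map_zero, inner_zero_left, inner_zero_left]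
    | add a b ha hb =>
      rw [UniformSpace.Completion.coe_add, map_add, inner_add_left, inner_add_left, ha, hb]
    | tmul a b =>
      induction w using TensorProduct.induction_on with
      | zero => rw [UniformSpace.Completion.coe_zero, map_zero, inner_zero_right, inner_zero_right]
      | add a b ha hb =>
        rw [UniformSpace.Completion.coe_add, map_add, inner_add_right, inner_add_right, ha, hb]
      | tmul c d =>
        simp [opTensor_tmul, UniformSpace.Completion.inner_coe, TensorProduct.inner_tmul,
          ContinuousLinearMap.star_eq_adjoint, ContinuousLinearMap.adjoint_inner_left]

/-- The tensor product `U ⊗ V` of two unitary representations. -/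
def tensorRep {Γ : Type*} [Group Γ] (U : Γ →* unitary (E →L[ℂ] E)) (V : Γ →* unitary (F →L[ℂ] F)) :
    Γ →* unitary (HilbertTensor E F →L[ℂ] HilbertTensor E F) where
  toFun g := ⟨opTensor (U g) (V g), by
    rw [Unitary.mem_iff, opTensor_star, ← opTensor_mul, ← opTensor_mul]
    simp [opTensor_one]⟩
  map_one' := Subtype.ext (by simp [opTensor_one])
  map_mul' g h := Subtype.ext (by simp [opTensor_mul])

/-- The von Neumann algebra tensor product `M ⊗̄ N`, generated by the operators `x ⊗ y` with `x ∈ M`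
and `y ∈ N`. -/
def vonNeumannTensor (M : VonNeumannAlgebra E) (N : VonNeumannAlgebra F) :
    VonNeumannAlgebra (HilbertTensor E F) :=
  vonNeumannClosure {z | ∃ x ∈ M, ∃ y ∈ N, z = opTensor x y}

theorem opTensor_mem {M : VonNeumannAlgebra E} {N : VonNeumannAlgebra F} {x : E →L[ℂ] E}
    {y : F →L[ℂ] F} (hx : x ∈ M) (hy : y ∈ N) :
    opTensor x y ∈ (vonNeumannTensor M N).toStarSubalgebra :=
  subset_vonNeumannClosure _ ⟨x, hx, y, hy, rfl⟩

end Tensor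

/-! ### Crossed products -/

section Crossed

variable {Γ : Type*} {K : Type*} [NormedAddCommGroup K] [InnerProductSpace ℂ K]

theorem memℓp_diag (T : Γ → (K →L[ℂ] K)) (C : ℝ) (hT : ∀ h, ‖T h‖ ≤ C)
    (ξ : lp (fun _ : Γ => K) 2) : Memℓp (fun h => T h (ξ h)) 2 :=
  ((lp.memℓp ξ).norm.const_mul C).mono fun h =>
    (T h).le_of_opNorm_le (hT h) _

/-- The diagonal operator `(ξ_h)_h ↦ (T_h ξ_h)_h` on `ℓ²(Γ, K)` given by a bounded family `T`. -/
def diagOp (T : Γ → (K →L[ℂ] K)) (C : ℝ) (hT : ∀ h, ‖T h‖ ≤ C) :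
    lp (fun _ : Γ => K) 2 →L[ℂ] lp (fun _ : Γ => K) 2 :=
  LinearMap.mkContinuous
    { toFun := fun ξ => ⟨fun h => T h (ξ h), memℓp_diag T C hT ξ⟩
      map_add' := fun ξ η => lp.ext (funext fun h => map_add (T h) (ξ h) (η h))
      map_smul' := fun c ξ => lp.ext (funext fun h => map_smul (T h) c (ξ h)) }
    |C| fun ξ => by
      have : |C| * ‖ξ‖ = ‖(C : ℂ) • ξ‖ := by
        rw [norm_smul, Complex.norm_real, Real.norm_eq_abs]
      rw [this]
      refine lp.norm_mono (by norm_num) fun h => ?_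
      refine ((T h).le_of_opNorm_le (hT h) _).trans ?_
      rw [lp.coeFn_smul, Pi.smul_apply, norm_smul]
      exact mul_le_mul_of_nonneg_right (by simpa using le_abs_self C) (norm_nonneg _)

theorem diagOp_apply (T : Γ → (K →L[ℂ] K)) (C : ℝ) (hT : ∀ h, ‖T h‖ ≤ C)
    (ξ : lp (fun _ : Γ => K) 2) (h : Γ) : diagOp T C hT ξ h = T h (ξ h) := rfl

variable [Group Γ]

/-- The left translation `(λ_g ξ)(h) = ξ(g⁻¹ h)` on `ℓ²(Γ, K)`. -/
def leftShift (g : Γ) : lp (fun _ : Γ => K) 2 →L[ℂ] lp (fun _ : Γ => K) 2 :=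
  LinearMap.mkContinuous
    { toFun := fun ξ => ⟨fun h => ξ (g⁻¹ * h), by
        refine memℓp_gen ?_
        exact ((lp.memℓp ξ).summable (by norm_num)).comp_injective (mul_right_injective g⁻¹)⟩
      map_add' := fun ξ η => rfl
      map_smul' := fun c ξ => rfl }
    1 fun ξ => by
      rw [one_mul]
      refine lp.norm_le_of_tsum_le (by norm_num) (norm_nonneg _) (le_of_eq ?_)
      rw [lp.norm_rpow_eq_tsum (by norm_num)]
      exact (Equiv.mulLeft g⁻¹).tsum_eq (fun h => ‖ξ h‖ ^ (2 : ℝ≥0∞).toReal)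

theorem leftShift_apply (g : Γ) (ξ : lp (fun _ : Γ => K) 2) (h : Γ) :
    leftShift g ξ h = ξ (g⁻¹ * h) := rfl

variable [CompleteSpace K] (U : Γ →* unitary (K →L[ℂ] K))

/-- The automorphism `σ_g = Ad U_g`, `σ_g(x) = U_g x U_g*`, of the bounded operators. -/
def conj (g : Γ) (x : K →L[ℂ] K) : K →L[ℂ] K :=
  (U g : K →L[ℂ] K) * x * star (U g : K →L[ℂ] K)

theorem norm_conj_le (g : Γ) (x : K →L[ℂ] K) : ‖conj U g x‖ ≤ ‖x‖ := by
  rw [conj, CStarRing.norm_mul_mem_unitary _ (Unitary.star_mem (U g).2), 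
    CStarRing.norm_mem_unitary_mul _ (U g).2]

/-- The representation `(π_σ(x) ξ)(h) = σ_{h⁻¹}(x) ξ(h)` of operators `x` on `K` by operators on
`ℓ²(Γ, K)`. -/
def crossedRep (x : K →L[ℂ] K) : lp (fun _ : Γ => K) 2 →L[ℂ] lp (fun _ : Γ => K) 2 :=
  diagOp (fun h => conj U h⁻¹ x) ‖x‖ fun h => norm_conj_le U h⁻¹ x

/-- The crossed product `N ⋊ Γ` of a von Neumann algebra `N` on `K` by the action `σ_g = Ad U_g` of
`Γ`, where the unitaries `U_g` normalize `N`. It is the von Neumann algebra on `ℓ²(Γ, K)` generated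
by the operators `π_σ(x)` with `x ∈ N` and the translations `λ_g` with `g ∈ Γ`. -/
def crossedProduct (N : VonNeumannAlgebra K) : VonNeumannAlgebra (lp (fun _ : Γ => K) 2) :=
  vonNeumannClosure ({z | ∃ x ∈ N, z = crossedRep U x} ∪ Set.range leftShift)

/-- The copy in `N ⋊ Γ` of an element of `N`. -/
def crossedIncl (N : VonNeumannAlgebra K) (x : N.toStarSubalgebra) :
    (crossedProduct U N).toStarSubalgebra :=
  ⟨crossedRep U x, subset_vonNeumannClosure _ (Or.inl ⟨x, x.2, rfl⟩)⟩

/-- The canonical unitaries `u_g` of `N ⋊ Γ`. -/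
def crossedUnitary (N : VonNeumannAlgebra K) (g : Γ) : (crossedProduct U N).toStarSubalgebra :=
  ⟨leftShift g, subset_vonNeumannClosure _ (Or.inr ⟨g, rfl⟩)⟩

/-- The canonical unitaries implement the action: `u_g x u_g* = σ_g(x)`, or `u_g x = σ_g(x) u_g`. -/
theorem leftShift_mul_crossedRep (g : Γ) (x : K →L[ℂ] K) :
    (leftShift g : lp (fun _ : Γ => K) 2 →L[ℂ] _) * crossedRep U x =
      crossedRep U (conj U g x) * leftShift g := by
  ext ξ h
  change conj U (g⁻¹ * h)⁻¹ x (ξ (g⁻¹ * h)) = conj U h⁻¹ (conj U g x) (ξ (g⁻¹ * h))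
  simp [conj, mul_assoc]

end Crossed

/-! ### Multiplication and Koopman operators -/

section Multiplication

variable {Z : Type*} [MeasurableSpace Z] (ν : Measure Z)

/-- The operator of multiplication by `f ∈ L^∞(Z, ν)` on `L²(Z, ν)`. -/
def mulOp (f : Lp ℂ ∞ ν) : Lp ℂ 2 ν →L[ℂ] Lp ℂ 2 ν :=
  (ContinuousLinearMap.mul ℂ ℂ).holderL ν ∞ 2 2 f

theorem mulOp_apply (f : Lp ℂ ∞ ν) (ψ : Lp ℂ 2 ν) :
    mulOp ν f ψ =ᵐ[ν] fun z => f z * ψ z :=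
  (ContinuousLinearMap.mul ℂ ℂ).coeFn_holder (r := 2) f ψ

/-- The unitary representation `(U_g ψ)(z) = ψ(T_g z)` on `L²(Z, ν)` given by measure preserving
maps `T_g` with `T_{gh} = T_h ∘ T_g` almost everywhere. -/
def koopmanRep {Γ : Type*} [Group Γ] (T : Γ → Z → Z) (hT : ∀ g, MeasurePreserving (T g) ν ν)
    (h_one : T 1 =ᵐ[ν] id) (h_mul : ∀ g h, T (g * h) =ᵐ[ν] T h ∘ T g) :
    Γ →* unitary (Lp ℂ 2 ν →L[ℂ] Lp ℂ 2 ν) :=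
  let V : Γ → (Lp ℂ 2 ν →ₗᵢ[ℂ] Lp ℂ 2 ν) :=
    fun g => Lp.compMeasurePreservingₗᵢ ℂ (T g) (hT g)
  have hV : ∀ g (ψ : Lp ℂ 2 ν), V g ψ =ᵐ[ν] fun z => ψ (T g z) :=
    fun g ψ => Lp.coeFn_compMeasurePreserving ψ (hT g)
  have hV1 : ∀ ψ : Lp ℂ 2 ν, V 1 ψ = ψ := fun ψ => Lp.ext (by
    filter_upwards [hV 1 ψ, h_one] with z h1 h2
    rw [h1, h2, id])
  have hVmul : ∀ g h (ψ : Lp ℂ 2 ν), V (g * h) ψ = V g (V h ψ) := fun g h ψ => Lp.ext (by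
    filter_upwards [hV (g * h) ψ, hV g (V h ψ), (hT g).quasiMeasurePreserving.ae (hV h ψ),
      h_mul g h] with z h1 h2 h3 h4
    rw [h1, h2, h3, h4, Function.comp_apply])
  have hVstar : ∀ g, star (V g).toContinuousLinearMap = (V g⁻¹).toContinuousLinearMap := by
    intro g
    rw [ContinuousLinearMap.star_eq_adjoint]
    symm
    rw [ContinuousLinearMap.eq_adjoint_iff]
    intro x y
    change ⟪V g⁻¹ x, y⟫_ℂ = ⟪x, V g y⟫_ℂ
    rw [← (V g).inner_map_map, ← hVmul, mul_inv_cancel, hV1]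
  { toFun := fun g => ⟨(V g).toContinuousLinearMap, by
      rw [Unitary.mem_iff, hVstar]
      constructor
      · ext1 ψ
        change V g⁻¹ (V g ψ) = ψ
        rw [← hVmul, inv_mul_cancel, hV1]
      · ext1 ψ
        change V g (V g⁻¹ ψ) = ψ
        rw [← hVmul, mul_inv_cancel, hV1]⟩
    map_one' := Subtype.ext (ContinuousLinearMap.ext hV1)
    map_mul' := fun g h => Subtype.ext (ContinuousLinearMap.ext (hVmul g h)) }

theorem koopmanRep_apply {Γ : Type*} [Group Γ] (T : Γ → Z → Z)
    (hT : ∀ g, MeasurePreserving (T g) ν ν) (h_one : T 1 =ᵐ[ν] id)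
    (h_mul : ∀ g h, T (g * h) =ᵐ[ν] T h ∘ T g) (g : Γ) (ψ : Lp ℂ 2 ν) :
    (koopmanRep ν T hT h_one h_mul g : Lp ℂ 2 ν →L[ℂ] Lp ℂ 2 ν) ψ =ᵐ[ν] fun z => ψ (T g z) :=
  Lp.coeFn_compMeasurePreserving ψ (hT g)

/-- `L^∞(Z, ν)` as a von Neumann algebra acting on `L²(Z, ν)` by multiplication. The bicommutant adds
nothing for a probability measure, where the multiplication operators are maximal abelian. -/
def linftyAlgebra : VonNeumannAlgebra (Lp ℂ 2 ν) :=
  vonNeumannClosure (Set.range (mulOp ν))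

end Multiplication

/-! ### The Gaussian construction -/

section Gaussian

/-- The product measure `∏ (ℝ, (2π)^{-1/2} e^{-x²/2} dx)`. -/
def gaussianProduct (ι : Type*) : Measure (ι → ℝ) := Measure.infinitePi fun _ : ι => gaussianReal 0 1

instance (ι : Type*) : IsProbabilityMeasure (gaussianProduct ι) := by
  unfold gaussianProduct; infer_instance

variable {ι : Type*}

theorem memLp_coord (n : ι) : MemLp (fun z : ι → ℝ => z n) 2 (gaussianProduct ι) :=
  (memLp_id_gaussianReal' 2 (by simp)).comp_measurePreserving
    (measurePreserving_eval_infinitePi (fun _ : ι => gaussianReal 0 1) n)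

theorem map_coord (n : ι) : (gaussianProduct ι).map (fun z => z n) = gaussianReal 0 1 :=
  (measurePreserving_eval_infinitePi (fun _ : ι => gaussianReal 0 1) n).map_eq

/-- The `n`-th coordinate function in `L²(Z, ν; ℝ)`. -/
def coordLp (n : ι) : Lp ℝ 2 (gaussianProduct ι) := (memLp_coord n).toLp _

theorem orthonormal_coordLp : Orthonormal ℝ (coordLp : ι → Lp ℝ 2 (gaussianProduct ι)) := by
  classical
  have h0 : ∀ i : ι, ∫ z, z i ∂gaussianProduct ι = 0 := fun i => by
    have := integral_map (μ := gaussianProduct ι) (φ := fun z => z i) (f := fun x : ℝ => x)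
      (measurable_pi_apply i).aemeasurable (by fun_prop)
    rw [← this, map_coord]
    simp
  rw [orthonormal_iff_ite]
  intro i j
  have h1 : ⟪coordLp i, coordLp j⟫_ℝ = ∫ z, z i * z j ∂gaussianProduct ι := by
    rw [L2.inner_def]
    refine integral_congr_ae ?_
    filter_upwards [(memLp_coord i).coeFn_toLp, (memLp_coord j).coeFn_toLp] with z hi hj
    change ⟪((memLp_coord i).toLp _ : (ι → ℝ) → ℝ) z, ((memLp_coord j).toLp _ : (ι → ℝ) → ℝ) z⟫_ℝ = _
    rw [hi, hj]
    simp [mul_comm]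
  rw [h1]
  split_ifs with hij
  · subst hij
    have := integral_map (μ := gaussianProduct ι) (φ := fun z => z i) (f := fun x : ℝ => x * x)
      (measurable_pi_apply i).aemeasurable (by fun_prop)
    rw [← this, map_coord]
    have hv := variance_fun_id_gaussianReal (μ := 0) (v := 1)
    rw [variance_of_integral_eq_zero (by fun_prop) (by simp)] at hv
    simpa [sq] using hv
  · have hind := (iIndepFun_infinitePi (P := fun _ : ι => gaussianReal 0 1)
      (X := fun _ x => x) (fun _ => measurable_id)).indepFun hij
    have := hind.integral_fun_mul_eq_mul_integral (measurable_pi_apply i).aestronglyMeasurable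
      (measurable_pi_apply j).aestronglyMeasurable
    change ∫ z, z i * z j ∂(Measure.infinitePi fun _ : ι => gaussianReal 0 1) = 0
    rw [this]
    have := h0 i
    unfold gaussianProduct at this
    rw [this, zero_mul]

variable {H : Type*} [NormedAddCommGroup H] [InnerProductSpace ℝ H] (e : HilbertBasis ι ℝ H)

/-- The isometric embedding `H → L²(Z, ν; ℝ)`, `∑ cₙ eₙ ↦ ∑ cₙ zₙ`. -/
def gaussianField : H →ₗᵢ[ℝ] Lp ℝ 2 (gaussianProduct ι) :=
  orthonormal_coordLp.orthogonalFamily.linearIsometry.comp e.repr.toLinearIsometry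

theorem gaussianField_basis (n : ι) : gaussianField e (e n) =ᵐ[gaussianProduct ι] fun z => z n := by
  classical
  have : gaussianField e (e n) = coordLp n := by
    change orthonormal_coordLp.orthogonalFamily.linearIsometry (e.repr (e n)) = _
    rw [e.repr_self, OrthogonalFamily.linearIsometry_apply_single]
    simp
  rw [this]
  exact (memLp_coord n).coeFn_toLp

theorem gaussianField_sum {κ : Type*} (s : Finset κ) (c : κ → ℝ) (ξ : κ → H) :
    gaussianField e (∑ k ∈ s, c k • ξ k) =ᵐ[gaussianProduct ι]
      fun z => ∑ k ∈ s, c k * gaussianField e (ξ k) z := by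
  classical
  rw [map_sum]
  induction s using Finset.induction_on with
  | empty =>
    simp only [Finset.sum_empty]
    exact Lp.coeFn_zero _ _ _
  | insert a s ha ih =>
    simp only [Finset.sum_insert ha]
    rw [map_smul]
    filter_upwards [Lp.coeFn_add (c a • gaussianField e (ξ a)) (∑ k ∈ s, gaussianField e (c k • ξ k)),
      Lp.coeFn_smul (c a) (gaussianField e (ξ a)), ih] with z h1 h2 h3
    rw [h1, Pi.add_apply, h2, h3, Pi.smul_apply, smul_eq_mul]

theorem integral_exp_sum (s : Finset ι) (c : ι → ℝ) :
    ∫ z, Complex.exp (((∑ i ∈ s, c i * z i : ℝ) : ℂ) * Complex.I) ∂gaussianProduct ι =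
      Complex.exp (-((∑ i ∈ s, c i ^ 2 : ℝ) : ℂ) / 2) := by
  have hmeas : ∀ i, Measurable fun z : ι → ℝ => c i * z i :=
    fun i => measurable_const.mul (measurable_pi_apply i)
  have hind : iIndepFun (fun i (z : ι → ℝ) => c i * z i) (gaussianProduct ι) :=
    iIndepFun_infinitePi (P := fun _ : ι => gaussianReal 0 1) (X := fun i x => c i * x)
      (fun i => by fun_prop)
  have h := congrFun ((hind.precomp
    (Subtype.val_injective (p := fun i => i ∈ s))).charFun_map_fun_finsetSum_eq_prod
      (s := s) (X := fun i (z : ι → ℝ) => c i * z i)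
      (fun i _ => (hmeas i).aemeasurable)) 1
  rw [charFun_apply_real, integral_map (Finset.measurable_fun_sum s fun i _ =>
    hmeas i).aemeasurable (by fun_prop)] at h
  simp only [Complex.ofReal_one, one_mul] at h
  rw [h, Finset.prod_apply]
  have : ∀ i, charFun ((gaussianProduct ι).map fun z => c i * z i) 1 =
      Complex.exp (-((c i ^ 2 : ℝ) : ℂ) / 2) := by
    intro i
    have hm : (gaussianProduct ι).map (fun z => c i * z i) = (gaussianReal 0 1).map (c i * ·) := by
      rw [← map_coord i]
      exact (Measure.map_map (f := fun z : ι → ℝ => z i) (g := fun x : ℝ => c i * x)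
        (measurable_const.mul measurable_id) (measurable_pi_apply i)).symm
    rw [hm, gaussianReal_map_const_mul, charFun_gaussianReal]
    simp [neg_div]
  simp_rw [this]
  rw [← Complex.exp_sum]
  congr 1
  push_cast
  rw [neg_div, Finset.sum_div, ← Finset.sum_neg_distrib]
  exact Finset.sum_congr rfl fun i _ => by ring

/-- `gaussianField e ξ` has characteristic function `e^{-‖ξ‖²/2}`. -/
theorem integral_exp_gaussianField (ξ : H) :
    ∫ z, Complex.exp ((gaussianField e ξ z : ℂ) * Complex.I) ∂gaussianProduct ι =
      Complex.exp (-(‖ξ‖ ^ 2 : ℝ) / 2) := by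
  classical
  let f : H → ℂ := fun ξ =>
    ∫ z, Complex.exp ((gaussianField e ξ z : ℂ) * Complex.I) ∂gaussianProduct ι
  have hint : ∀ ξ, Integrable
      (fun z => Complex.exp ((gaussianField e ξ z : ℂ) * Complex.I)) (gaussianProduct ι) := by
    intro ξ
    refine Integrable.of_bound (C := 1) ?_ (Eventually.of_forall fun z => ?_)
    · exact (Complex.continuous_exp.comp_aestronglyMeasurable
        ((Complex.continuous_ofReal.comp_aestronglyMeasurable
          (Lp.aestronglyMeasurable _)).mul_const _))
    · rw [Complex.norm_exp_ofReal_mul_I]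
  have hlip : ∀ ξ η, ‖f ξ - f η‖ ≤ ‖ξ - η‖ := by
    intro ξ η
    have hI : Integrable (gaussianField e ξ - gaussianField e η : Lp ℝ 2 (gaussianProduct ι))
        (gaussianProduct ι) :=
      (Lp.memLp _).integrable (by norm_num)
    rw [← integral_sub (hint ξ) (hint η)]
    calc _ ≤ ∫ z, ‖(gaussianField e ξ - gaussianField e η : Lp ℝ 2 (gaussianProduct ι)) z‖
            ∂gaussianProduct ι := by
          refine norm_integral_le_of_norm_le hI.norm ?_
          filter_upwards [Lp.coeFn_sub (gaussianField e ξ) (gaussianField e η)] with z hz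
          rw [hz, Pi.sub_apply]
          have h1 : Complex.exp ((gaussianField e ξ z : ℂ) * Complex.I) -
              Complex.exp ((gaussianField e η z : ℂ) * Complex.I) =
              Complex.exp ((gaussianField e η z : ℂ) * Complex.I) *
              (Complex.exp (Complex.I * ((gaussianField e ξ z - gaussianField e η z : ℝ) : ℂ)) - 1) := by
            rw [mul_sub, ← Complex.exp_add, mul_one]
            congr 2
            push_cast
            ring
          rw [h1, norm_mul, Complex.norm_exp_ofReal_mul_I, one_mul]
          exact Real.norm_exp_I_mul_ofReal_sub_one_le
      _ ≤ ‖(gaussianField e ξ - gaussianField e η : Lp ℝ 2 (gaussianProduct ι))‖ := by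
          rw [integral_norm_eq_lintegral_enorm hI.1, ← eLpNorm_one_eq_lintegral_enorm, Lp.norm_def]
          exact ENNReal.toReal_mono (Lp.eLpNorm_ne_top _)
            (eLpNorm_le_eLpNorm_of_exponent_le (by norm_num) hI.1)
      _ = ‖ξ - η‖ := by rw [← map_sub, LinearIsometry.norm_map]
  have hcont : Continuous f :=
    (LipschitzWith.of_dist_le_mul (K := 1) fun ξ η => by
      simpa [dist_eq_norm] using hlip ξ η).continuous
  have hlim : Tendsto (fun s : Finset ι => ∑ i ∈ s, e.repr ξ i • e i) atTop (𝓝 ξ) :=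
    e.hasSum_repr ξ
  refine tendsto_nhds_unique ((hcont.tendsto ξ).comp hlim) ?_
  have h2 : Tendsto (fun s : Finset ι =>
      Complex.exp (-(‖∑ i ∈ s, e.repr ξ i • e i‖ ^ 2 : ℝ) / 2)) atTop
      (𝓝 (Complex.exp (-(‖ξ‖ ^ 2 : ℝ) / 2))) :=
    ((by fun_prop : Continuous fun ζ : H => Complex.exp (-((‖ζ‖ ^ 2 : ℝ) : ℂ) / 2)).tendsto ξ).comp hlim
  refine h2.congr fun s => ?_
  have h3 : ‖∑ i ∈ s, e.repr ξ i • e i‖ ^ 2 = ∑ i ∈ s, e.repr ξ i ^ 2 := by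
    rw [← real_inner_self_eq_norm_sq, e.orthonormal.inner_sum]
    exact Finset.sum_congr rfl fun i _ => by simp [sq]
  rw [h3, ← integral_exp_sum]
  refine integral_congr_ae ?_
  have h4 : ∀ᵐ z ∂gaussianProduct ι, ∀ i ∈ s, gaussianField e (e i) z = z i :=
    (Finset.eventually_all s).2 fun i _ => gaussianField_basis e i
  filter_upwards [gaussianField_sum e s (e.repr ξ) e, h4] with z hz hz'
  rw [hz]
  congr 3
  exact (Finset.sum_congr rfl fun i hi => by rw [hz' i hi]).symm

/-- The transformation of `Z` with coordinates `(T z)_n = (gaussianField e (R e_n))(z)`. -/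
def gaussianMap (R : H ≃ₗᵢ[ℝ] H) (z : ι → ℝ) : ι → ℝ := fun n => gaussianField e (R (e n)) z

theorem measurable_gaussianMap (R : H ≃ₗᵢ[ℝ] H) : Measurable (gaussianMap e R) :=
  measurable_pi_lambda _ fun _ => (Lp.stronglyMeasurable _).measurable

theorem measurePreserving_gaussianMap (R : H ≃ₗᵢ[ℝ] H) :
    MeasurePreserving (gaussianMap e R) (gaussianProduct ι) (gaussianProduct ι) := by
  refine ⟨measurable_gaussianMap e R, ?_⟩
  have hlim : IsProjectiveLimit (gaussianProduct ι)
      (fun I : Finset ι => Measure.pi fun _ : I => gaussianReal 0 1) :=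
    Measure.isProjectiveLimit_infinitePi fun _ : ι => gaussianReal 0 1
  refine IsProjectiveLimit.unique ?_ hlim
  intro s
  rw [Measure.map_map (Finset.measurable_restrict s) (measurable_gaussianMap e R)]
  have hm : Measurable (s.restrict ∘ gaussianMap e R) :=
    (Finset.measurable_restrict s).comp (measurable_gaussianMap e R)
  have := Measure.isProbabilityMeasure_map (μ := gaussianProduct ι) hm.aemeasurable
  rw [← charFun_eq_pi_iff]
  intro t
  rw [charFun_apply, integral_map (by fun_prop) (by fun_prop),
    integral_map hm.aemeasurable (by fun_prop)]
  simp_rw [charFun_gaussianReal]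
  rw [← Complex.exp_sum]
  have h1 := integral_exp_gaussianField e (∑ i : s, t i • R (e i))
  have h2 : ‖∑ i : s, t i • R (e i)‖ ^ 2 = ∑ i : s, t i ^ 2 := by
    have ho : Orthonormal ℝ (fun i : s => R (e i)) :=
      (e.orthonormal.comp_linearIsometryEquiv R).comp _ Subtype.val_injective
    rw [← real_inner_self_eq_norm_sq, ho.inner_sum]
    exact Finset.sum_congr rfl fun i _ => by simp [sq]
  rw [h2] at h1
  convert h1 using 1
  · refine integral_congr_ae ?_
    filter_upwards [gaussianField_sum e Finset.univ t (fun i : s => R (e i))] with z hz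
    rw [hz, PiLp.inner_apply]
    congr 3
  · congr 1
    push_cast
    rw [neg_div, Finset.sum_div, ← Finset.sum_neg_distrib]
    exact Finset.sum_congr rfl fun i _ => by simp

/-- `gaussianField e ξ` composed with the transformation given by `R` is `gaussianField e (R ξ)`. -/
theorem gaussianField_gaussianMap (R : H ≃ₗᵢ[ℝ] H) (ξ : H) :
    (fun z => gaussianField e ξ (gaussianMap e R z)) =ᵐ[gaussianProduct ι]
      gaussianField e (R ξ) := by
  classical
  let C : Lp ℝ 2 (gaussianProduct ι) →ₗᵢ[ℝ] Lp ℝ 2 (gaussianProduct ι) :=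
    Lp.compMeasurePreservingₗᵢ ℝ (gaussianMap e R) (measurePreserving_gaussianMap e R)
  have hC : ∀ ψ : Lp ℝ 2 (gaussianProduct ι),
      C ψ =ᵐ[gaussianProduct ι] fun z => ψ (gaussianMap e R z) :=
    fun ψ => Lp.coeFn_compMeasurePreserving ψ (measurePreserving_gaussianMap e R)
  have key : C (gaussianField e ξ) = gaussianField e (R ξ) := by
    have hlim := e.hasSum_repr ξ
    have h1 := hlim.mapL (C.comp (gaussianField e)).toContinuousLinearMap
    have h2 := hlim.mapL ((gaussianField e).comp R.toLinearIsometry).toContinuousLinearMap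
    refine h1.unique (h2.congr_fun ?_)
    intro i
    change C (gaussianField e (e.repr ξ i • e i)) = gaussianField e (R (e.repr ξ i • e i))
    simp only [map_smul]
    congr 1
    refine Lp.ext ?_
    filter_upwards [hC (gaussianField e (e i)),
      (measurePreserving_gaussianMap e R).quasiMeasurePreserving.ae (gaussianField_basis e i)]
      with z h3 h4
    rw [h3, h4]
    rfl
  rw [← key]
  exact (hC _).symm

theorem memLp_omega (ξ : H) :
    MemLp (fun z => Complex.exp (√2 * Complex.I * gaussianField e ξ z)) ∞ (gaussianProduct ι) := by
  refine memLp_top_of_bound ?_ 1 (Eventually.of_forall fun z => ?_)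
  · exact (Complex.continuous_exp.comp_aestronglyMeasurable
      ((Complex.continuous_ofReal.comp_aestronglyMeasurable
        (Lp.aestronglyMeasurable _)).const_mul _))
  · have : (√2 * Complex.I * gaussianField e ξ z : ℂ) =
        ((√2 * gaussianField e ξ z : ℝ) : ℂ) * Complex.I := by
      push_cast; ring
    rw [this, Complex.norm_exp_ofReal_mul_I]

/-- The unitary `ω(ξ) = exp(√2 i ∑ₙ cₙ zₙ) ∈ L^∞(Z, ν)`, for `ξ = ∑ₙ cₙ eₙ ∈ H`. For a finite sum
this is a pointwise formula; in general the sum in the exponent converges in `L²(Z, ν)`. -/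
def omega (ξ : H) : Lp ℂ ∞ (gaussianProduct ι) := (memLp_omega e ξ).toLp _

theorem omega_finset_sum (s : Finset ι) (c : ι → ℝ) :
    omega e (∑ n ∈ s, c n • e n) =ᵐ[gaussianProduct ι]
      fun z => Complex.exp (√2 * Complex.I * ∑ n ∈ s, (c n : ℂ) * z n) := by
  have h : ∀ᵐ z ∂gaussianProduct ι, ∀ i ∈ s, gaussianField e (e i) z = z i :=
    (Finset.eventually_all s).2 fun i _ => gaussianField_basis e i
  filter_upwards [(memLp_omega e (∑ n ∈ s, c n • e n)).coeFn_toLp, gaussianField_sum e s c e, h]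
    with z h1 h2 h3
  rw [omega, h1, h2, Finset.sum_congr rfl fun i hi => by rw [h3 i hi]]
  push_cast
  rfl

theorem omega_add (ξ η : H) :
    omega e (ξ + η) =ᵐ[gaussianProduct ι] fun z => omega e ξ z * omega e η z := by
  filter_upwards [(memLp_omega e ξ).coeFn_toLp, (memLp_omega e η).coeFn_toLp,
    (memLp_omega e (ξ + η)).coeFn_toLp, Lp.coeFn_add (gaussianField e ξ) (gaussianField e η)]
    with z h1 h2 h3 h4
  rw [omega, h3, omega, h1, omega, h2, map_add, h4, ← Complex.exp_add, Pi.add_apply]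
  congr 1
  push_cast
  ring

/-- The trace of `ω(ξ)` is `e^{-‖ξ‖²}`. -/
theorem integral_omega (ξ : H) :
    ∫ z, omega e ξ z ∂gaussianProduct ι = Complex.exp (-(‖ξ‖ ^ 2 : ℝ)) := by
  have h := integral_exp_gaussianField e (√2 • ξ)
  rw [norm_smul, mul_pow, Real.norm_eq_abs, sq_abs, Real.sq_sqrt (by norm_num)] at h
  convert h using 1
  · refine integral_congr_ae ?_
    filter_upwards [(memLp_omega e ξ).coeFn_toLp, Lp.coeFn_smul √2 (gaussianField e ξ)] with z h1 h2
    rw [omega, h1, map_smul, h2, Pi.smul_apply, smul_eq_mul]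
    congr 1
    push_cast
    ring
  · congr 1
    push_cast
    ring

/-- The von Neumann algebra `D ⊆ L^∞(Z, ν)` generated by the unitaries `ω(ξ)`, `ξ ∈ H`. -/
def gaussianAlgebra : VonNeumannAlgebra (Lp ℂ 2 (gaussianProduct ι)) :=
  vonNeumannClosure (Set.range fun ξ : H => mulOp (gaussianProduct ι) (omega e ξ))

variable {Γ : Type*} [Group Γ] [Countable ι] (π : Γ →* (H ≃ₗᵢ[ℝ] H))

/-- The unitary representation of `Γ` on `L²(Z, ν)` that implements the Gaussian action. -/
def gaussianRep : Γ →* unitary (Lp ℂ 2 (gaussianProduct ι) →L[ℂ] Lp ℂ 2 (gaussianProduct ι)) :=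
  koopmanRep (gaussianProduct ι) (fun g => gaussianMap e (π g))
    (fun g => measurePreserving_gaussianMap e (π g))
    (by
      filter_upwards [ae_all_iff.2 fun n => gaussianField_basis e n] with z hz
      funext n
      simpa [gaussianMap] using hz n)
    (fun g h => by
      filter_upwards [ae_all_iff.2 fun n => gaussianField_gaussianMap e (π g) (π h (e n))]
        with z hz
      funext n
      simpa [gaussianMap] using (hz n).symm)

/-- The Gaussian action on `D` is determined by `γ · ω(ξ) = ω(π(γ) ξ)`. -/
theorem conj_gaussianRep_omega (g : Γ) (ξ : H) :
    conj (gaussianRep e π) g (mulOp (gaussianProduct ι) (omega e ξ)) =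
      mulOp (gaussianProduct ι) (omega e (π g ξ)) := by
  have hU := (gaussianRep e π g).2
  have key : (gaussianRep e π g : Lp ℂ 2 (gaussianProduct ι) →L[ℂ] Lp ℂ 2 (gaussianProduct ι)) *
      mulOp (gaussianProduct ι) (omega e ξ) =
      mulOp (gaussianProduct ι) (omega e (π g ξ)) * gaussianRep e π g := by
    ext1 ψ
    refine Lp.ext ?_
    have hT := (measurePreserving_gaussianMap e (π g)).quasiMeasurePreserving
    have hU : ∀ φ : Lp ℂ 2 (gaussianProduct ι),
        (gaussianRep e π g : Lp ℂ 2 (gaussianProduct ι) →L[ℂ] Lp ℂ 2 (gaussianProduct ι)) φ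
          =ᵐ[gaussianProduct ι] fun z => φ (gaussianMap e (π g) z) :=
      fun φ => koopmanRep_apply _ _ _ _ _ g φ
    filter_upwards [hU (mulOp (gaussianProduct ι) (omega e ξ) ψ), hU ψ,
      hT.ae (mulOp_apply (gaussianProduct ι) (omega e ξ) ψ),
      mulOp_apply (gaussianProduct ι) (omega e (π g ξ)) ((gaussianRep e π g :
        Lp ℂ 2 (gaussianProduct ι) →L[ℂ] Lp ℂ 2 (gaussianProduct ι)) ψ),
      hT.ae (memLp_omega e ξ).coeFn_toLp, (memLp_omega e (π g ξ)).coeFn_toLp,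
      gaussianField_gaussianMap e (π g) ξ] with z h1 h2 h3 h4 h5 h6 h7
    refine h1.trans (h3.trans (Eq.trans ?_ h4.symm))
    rw [h2, omega, h5, omega, h6, h7]
  rw [conj, key, mul_assoc, Unitary.mul_star_self_of_mem hU, mul_one]

end Gaussian

/-! ### The algebra `M̃ = (D ⊗̄ A) ⋊ Γ` and its deformation -/

section Deformation

variable {Γ : Type*} [Group Γ] {X : Type*} [MeasurableSpace X] (μ : Measure X)
  [MulAction Γ X] [MeasurableConstSMul Γ X] [SMulInvariantMeasure Γ X μ]

/-- The unitary representation `(V_g ψ)(x) = ψ(g⁻¹ x)` on `L²(X, μ)`. -/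
def actionRep : Γ →* unitary (Lp ℂ 2 μ →L[ℂ] Lp ℂ 2 μ) :=
  koopmanRep μ (fun g x => g⁻¹ • x) (fun g => measurePreserving_smul g⁻¹ μ)
    (Eventually.of_forall fun x => by simp)
    (fun g h => Eventually.of_forall fun x => by simp [mul_smul])

variable {ι : Type*} {H : Type*} [NormedAddCommGroup H] [InnerProductSpace ℝ H]
  (e : HilbertBasis ι ℝ H)

/-- The von Neumann algebra `D ⊗̄ A` on `L²(Z, ν) ⊗ L²(X, μ)`, where `A = L^∞(X, μ)`. -/
def baseAlgebra : VonNeumannAlgebra (HilbertTensor (Lp ℂ 2 (gaussianProduct ι)) (Lp ℂ 2 μ)) :=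
  vonNeumannTensor (gaussianAlgebra e) (linftyAlgebra μ)

/-- The element `ω(ξ) ⊗ 1` of `D ⊗̄ A`. -/
def omegaTensorOne (ξ : H) : (baseAlgebra μ e).toStarSubalgebra :=
  ⟨opTensor (mulOp (gaussianProduct ι) (omega e ξ)) 1,
    opTensor_mem (subset_vonNeumannClosure _ ⟨ξ, rfl⟩)
      (one_mem (linftyAlgebra μ).toStarSubalgebra)⟩

/-- The unit vector `1 ⊗ 1` of `L²(Z, ν) ⊗ L²(X, μ)`. -/
def baseVector [IsProbabilityMeasure μ] :
    HilbertTensor (Lp ℂ 2 (gaussianProduct ι)) (Lp ℂ 2 μ) :=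
  ((Lp.const 2 (gaussianProduct ι) (1 : ℂ) ⊗ₜ[ℂ] Lp.const 2 μ (1 : ℂ) :
    Lp ℂ 2 (gaussianProduct ι) ⊗[ℂ] Lp ℂ 2 μ) : HilbertTensor _ _)

variable [Countable ι] (π : Γ →* (H ≃ₗᵢ[ℝ] H))

/-- The unitary representation on `L²(Z, ν) ⊗ L²(X, μ)` implementing the diagonal action `σ` of `Γ` on
`D ⊗̄ A`. -/
def diagonalRep : Γ →* unitary (HilbertTensor (Lp ℂ 2 (gaussianProduct ι)) (Lp ℂ 2 μ) →L[ℂ]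
    HilbertTensor (Lp ℂ 2 (gaussianProduct ι)) (Lp ℂ 2 μ)) :=
  tensorRep (gaussianRep e π) (actionRep μ)

/-- The von Neumann algebra `M̃ = (D ⊗̄ A) ⋊ Γ`, as a von Neumann algebra of operators. -/
def tildeM : VonNeumannAlgebra
    (lp (fun _ : Γ => HilbertTensor (Lp ℂ 2 (gaussianProduct ι)) (Lp ℂ 2 μ)) 2) :=
  crossedProduct (diagonalRep μ e π) (baseAlgebra μ e)

/-- The algebra `M̃` as a type. -/
abbrev TildeM : Type _ := (tildeM μ e π).toStarSubalgebra

/-- The inclusion `D ⊗̄ A → M̃`. -/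
def baseIncl (x : (baseAlgebra μ e).toStarSubalgebra) : TildeM μ e π :=
  crossedIncl (diagonalRep μ e π) (baseAlgebra μ e) x

/-- The canonical unitaries `u_g ∈ M̃`. -/
def canonicalUnitary (g : Γ) : TildeM μ e π :=
  crossedUnitary (diagonalRep μ e π) (baseAlgebra μ e) g

/-- The requirements on `α_t` for a `*`-endomorphism `β` of `M̃`: it is normal, it is the identity on
`D ⊗̄ A`, and it maps `u_g` to `(ω(t b(g)) ⊗ 1) u_g`. -/
def IsDeformation (b : Γ → H) (t : ℝ) (β : TildeM μ e π → TildeM μ e π) : Prop :=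
  IsNormalMap (tildeM μ e π) β ∧
  (∀ x : (baseAlgebra μ e).toStarSubalgebra, β (baseIncl μ e π x) = baseIncl μ e π x) ∧
  ∀ g : Γ, β (canonicalUnitary μ e π g) =
    baseIncl μ e π (omegaTensorOne μ e (t • b g)) * canonicalUnitary μ e π g

variable [IsProbabilityMeasure μ]

open Classical in
/-- The canonical trace `τ(x) = ⟪Ω, x Ω⟫` of `M̃`, where `Ω = δ_1 ⊗ (1 ⊗ 1)`. It sends `∑_g x_g u_g` to
`∫ x_1 d(ν × μ)`. -/
def trace (x : TildeM μ e π) : ℂ :=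
  ⟪lp.single 2 (1 : Γ) (baseVector μ),
    (x : lp (fun _ : Γ => HilbertTensor (Lp ℂ 2 (gaussianProduct ι)) (Lp ℂ 2 μ)) 2 →L[ℂ]
      lp (fun _ : Γ => HilbertTensor (Lp ℂ 2 (gaussianProduct ι)) (Lp ℂ 2 μ)) 2)
      (lp.single 2 (1 : Γ) (baseVector μ))⟫_ℂ

/-- The 2-norm `‖x‖₂ = τ(x* x)^{1/2}`. -/
def twoNorm (x : TildeM μ e π) : ℝ := √(trace μ e π (star x * x)).re

end Deformation

end CocycleDeformation
end

noncomputable section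

namespace CocycleDeformation

/-!
Write `σ` for the diagonal action on `D ⊗̄ A` and let `W_t` be the diagonal unitary on
`ℓ²(Γ, L²(Z) ⊗ L²(X))` with entries `σ_{h⁻¹}(ω(t b(h)) ⊗ 1)`. Then `α_t = Ad W_t`: since
`ω(ξ) ⊗ 1` is central in `D ⊗̄ A` and `g ↦ ω(t b(g)) ⊗ 1` is a 1-cocycle for `σ`, conjugation by
`W_t` fixes `D ⊗̄ A` and maps `u_g` to `(ω(t b(g)) ⊗ 1) u_g`. The unit vector `Ω = δ_1 ⊗ 1 ⊗ 1` is
fixed by `W_t`, so `‖α_t(x) - x‖₂ = ‖W_t x Ω - x Ω‖`, which tends to `0` because `W_t → 1`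
strongly. This reduces to `⟪1, ω(ξ) 1⟫ = exp(-‖ξ‖²) → 1` as `ξ → 0`, since the operators `ω(ξ)`
are unitary, commute with `L^∞(Z)` and `L^∞(Z) 1` is dense in `L²(Z)`. For uniqueness, a normal
functional is a vector functional on an amplification, and von Neumann's density argument shows
that it is determined by its values on a `*`-algebra that generates `M̃`.
-/

section DiagonalOperators

variable {κ K : Type*} [NormedAddCommGroup K] [InnerProductSpace ℂ K]

theorem diagOp_single [DecidableEq κ] (T : κ → (K →L[ℂ] K)) (C : ℝ) (hT : ∀ k, ‖T k‖ ≤ C)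
    (k : κ) (v : K) : diagOp T C hT (lp.single 2 k v) = lp.single 2 k (T k v) := by
  refine lp.ext (funext fun j => ?_)
  rw [diagOp_apply, lp.coeFn_single, lp.coeFn_single, Pi.apply_single (fun i => T i) (by simp)]

/-- The operator `1 ⊗ x` on `ℓ²(κ, K) = ℓ²(κ) ⊗ K`. -/
def amplify (κ : Type*) (x : K →L[ℂ] K) :
    lp (fun _ : κ => K) 2 →L[ℂ] lp (fun _ : κ => K) 2 :=
  diagOp (fun _ => x) ‖x‖ fun _ => le_rfl

theorem amplify_apply (x : K →L[ℂ] K) (ξ : lp (fun _ : κ => K) 2) (k : κ) :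
    amplify κ x ξ k = x (ξ k) := rfl

theorem amplify_single [DecidableEq κ] (x : K →L[ℂ] K) (k : κ) (v : K) :
    amplify κ x (lp.single 2 k v) = lp.single 2 k (x v) := diagOp_single _ _ _ k v

variable [CompleteSpace K]

theorem star_diagOp (T : κ → (K →L[ℂ] K)) (C : ℝ) (hT : ∀ k, ‖T k‖ ≤ C) :
    star (diagOp T C hT) =
      diagOp (fun k => star (T k)) C fun k => (norm_star (T k)).trans_le (hT k) := by
  rw [ContinuousLinearMap.star_eq_adjoint, eq_comm, ContinuousLinearMap.eq_adjoint_iff]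
  intro ξ η
  simp only [lp.inner_eq_tsum, diagOp_apply, ContinuousLinearMap.star_eq_adjoint,
    ContinuousLinearMap.adjoint_inner_left]

theorem norm_coe_unitary_le_one (u : unitary (K →L[ℂ] K)) : ‖(u : K →L[ℂ] K)‖ ≤ 1 :=
  ContinuousLinearMap.opNorm_le_bound _ zero_le_one fun v => by
    rw [one_mul, Unitary.norm_map]

/-- The unitary operator `(ξ_k)_k ↦ (c_k ξ_k)_k` on `ℓ²(κ, K)` given by a family of unitaries `c`,
as a homomorphism in `c`. -/
def diagUnitary : (κ → unitary (K →L[ℂ] K)) →*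
    unitary (lp (fun _ : κ => K) 2 →L[ℂ] lp (fun _ : κ => K) 2) where
  toFun c := ⟨diagOp (fun k => c k) 1 fun k => norm_coe_unitary_le_one (c k), by
    rw [Unitary.mem_iff, star_diagOp]
    constructor <;> ext ξ k
    · exact congr($(Unitary.coe_star_mul_self (c k)) (ξ k))
    · exact congr($(Unitary.coe_mul_star_self (c k)) (ξ k))⟩
  map_one' := rfl
  map_mul' _ _ := rfl

theorem diagUnitary_single [DecidableEq κ] (c : κ → unitary (K →L[ℂ] K)) (k : κ) (v : K) :
    (diagUnitary c).1 (lp.single 2 k v) = lp.single 2 k ((c k).1 v) :=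
  diagOp_single (fun k => (c k).1) 1 (fun k => norm_coe_unitary_le_one (c k)) k v

theorem star_amplify (x : K →L[ℂ] K) : star (amplify κ x) = amplify κ (star x) := by
  simp only [amplify, star_diagOp, norm_star]

end DiagonalOperators

section Bicommutant

variable {K : Type*} [NormedAddCommGroup K] [InnerProductSpace ℂ K] [CompleteSpace K]

theorem commute_of_mem_vonNeumannClosure {S : Set (K →L[ℂ] K)} {x y : K →L[ℂ] K}
    (h : ∀ s ∈ S, Commute s y) (h_star : ∀ s ∈ S, Commute (star s) y)
    (hx : x ∈ vonNeumannClosure S) : Commute x y :=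
  (StarSubalgebra.mem_centralizer_iff ℂ |>.1 hx y <| StarSubalgebra.mem_centralizer_iff ℂ |>.2
    fun s hs => ⟨h s hs, h_star s hs⟩).1.symm

theorem map_mem_of_mem_vonNeumannClosure {S : Set (K →L[ℂ] K)} {M : VonNeumannAlgebra K}
    (φ : (K →L[ℂ] K) ≃⋆ₐ[ℂ] (K →L[ℂ] K)) (h : ∀ s ∈ S, φ s ∈ M) {x : K →L[ℂ] K}
    (hx : x ∈ vonNeumannClosure S) : φ x ∈ M := by
  rw [← VonNeumannAlgebra.commutant_commutant M, VonNeumannAlgebra.mem_commutant_iff]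
  intro y hy
  have map_star (s : K →L[ℂ] K) : φ (star s) = star (φ s) := φ.map_star' s
  have commute_symm {z : K →L[ℂ] K} (hz : φ z ∈ M) : Commute z (φ.symm y) := by
    have := VonNeumannAlgebra.mem_commutant_iff.1 hy _ hz
    simpa using Commute.map (f := φ.symm) this
  have hxy := commute_of_mem_vonNeumannClosure (fun s hs => commute_symm (h s hs))
    (fun s hs => commute_symm (by rw [map_star]; exact star_mem (h s hs))) hx
  simpa using (hxy.map φ).symm.eq

variable {κ : Type*}

theorem commute_amplify_of_mem_vonNeumannClosure {S : StarSubalgebra ℂ (K →L[ℂ] K)}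
    {A : lp (fun _ : κ => K) 2 →L[ℂ] lp (fun _ : κ => K) 2}
    (hA : ∀ s ∈ S, Commute (amplify κ s) A) {x : K →L[ℂ] K}
    (hx : x ∈ vonNeumannClosure (S : Set (K →L[ℂ] K))) : Commute (amplify κ x) A := by
  classical
  let entry (i j : κ) : K →L[ℂ] K := lp.evalCLM ℂ (fun _ : κ => K) 2 i ∘L A ∘L
    lp.singleContinuousLinearMap ℂ (fun _ : κ => K) 2 j
  have entry_apply (i j : κ) (v : K) : entry i j v = A (lp.single 2 j v) i := rfl
  have commute_entry {s : K →L[ℂ] K} (hs : s ∈ S) (i j : κ) : Commute s (entry i j) := by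
    ext v
    have := congr($((hA s hs).eq) (lp.single 2 j v) i)
    simpa [amplify_apply, amplify_single, entry_apply] using this
  refine lp.ext_continuousLinearMap (by simp) fun j => ?_
  ext v i
  have := commute_of_mem_vonNeumannClosure (fun s hs => commute_entry hs i j)
    (fun s hs => commute_entry (star_mem hs) i j) hx
  simpa [amplify_apply, amplify_single, entry_apply] using congr($(this.eq) v)

theorem commute_starProjection {V : Submodule ℂ K} [V.HasOrthogonalProjection] {A : K →L[ℂ] K}
    (hA : ∀ v ∈ V, A v ∈ V) (hA_star : ∀ v ∈ V, star A v ∈ V) : Commute A V.starProjection := by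
  ext v
  refine (Submodule.eq_starProjection_of_mem_orthogonal
    (hA _ (V.starProjection_apply_mem v)) ?_).symm
  rw [ContinuousLinearMap.coe_coe, ← map_sub, Submodule.mem_orthogonal]
  intro u hu
  rw [← ContinuousLinearMap.adjoint_inner_left]
  exact V.sub_starProjection_mem_orthogonal v _ (hA_star u hu)

theorem amplify_mem_closure (S : StarSubalgebra ℂ (K →L[ℂ] K)) {x : K →L[ℂ] K}
    (hx : x ∈ vonNeumannClosure (S : Set (K →L[ℂ] K))) (η : lp (fun _ : κ => K) 2) :
    amplify κ x η ∈ closure ((fun s => amplify κ s η) '' S) := by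
  let orbitMap : (K →L[ℂ] K) →ₗ[ℂ] lp (fun _ : κ => K) 2 :=
    { toFun s := amplify κ s η, map_add' _ _ := rfl, map_smul' _ _ := rfl }
  let V := (S.toSubalgebra.toSubmodule.map orbitMap).topologicalClosure
  have hV {s : K →L[ℂ] K} (hs : s ∈ S) (ζ) (hζ : ζ ∈ V) : amplify κ s ζ ∈ V := by
    refine map_mem_closure (amplify κ s).continuous hζ ?_
    rintro _ ⟨t, ht, rfl⟩
    exact ⟨s * t, S.mul_mem hs ht, rfl⟩
  have : CompleteSpace V := (Submodule.isClosed_topologicalClosure _).completeSpace_coe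
  have hcomm : Commute (amplify κ x) V.starProjection :=
    commute_amplify_of_mem_vonNeumannClosure (fun s hs => commute_starProjection (hV hs)
      (by rw [star_amplify]; exact hV (star_mem hs))) hx
  have hη : V.starProjection η = η :=
    Submodule.starProjection_eq_self_iff.2 (subset_closure ⟨1, one_mem S, rfl⟩)
  have hxη : V.starProjection (amplify κ x η) = amplify κ x η := by
    simpa [hη] using congr($(hcomm.eq) η).symm
  exact Submodule.starProjection_eq_self_iff.1 hxη

end Bicommutant

section NormalMaps

variable {K : Type*} [NormedAddCommGroup K] [InnerProductSpace ℂ K] [CompleteSpace K]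
  {M : VonNeumannAlgebra K}

theorem isNormalFunctional_iff_inner_amplify {φ : M.toStarSubalgebra → ℂ} :
    IsNormalFunctional M φ ↔ ∃ ξ η : lp (fun _ : ℕ => K) 2,
      ∀ x : M.toStarSubalgebra, φ x = ⟪ξ, amplify ℕ (x : K →L[ℂ] K) η⟫_ℂ := by
  simp only [IsNormalFunctional, lp.inner_eq_tsum, amplify_apply]

theorem isNormalFunctional_inner (M : VonNeumannAlgebra K) (v w : K) :
    IsNormalFunctional M fun x => ⟪v, (x : K →L[ℂ] K) w⟫_ℂ :=
  isNormalFunctional_iff_inner_amplify.2 ⟨lp.single 2 0 v, lp.single 2 0 w, fun x => by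
    rw [amplify_single, lp.inner_single_left, lp.single_apply_self]⟩

omit [InnerProductSpace ℂ K] [CompleteSpace K] in
theorem memℓp_sumElim {ι κ : Type*} (ξ : lp (fun _ : ι => K) 2) (η : lp (fun _ : κ => K) 2) :
    Memℓp (E := fun _ : ι ⊕ κ => K) (Sum.elim ξ η) 2 :=
  memℓp_gen (((lp.memℓp ξ).summable (by norm_num)).sum _ ((lp.memℓp η).summable (by norm_num)))

theorem IsNormalFunctional.exists_sub_eq_inner_amplify {φ ψ : M.toStarSubalgebra → ℂ}
    (hφ : IsNormalFunctional M φ) (hψ : IsNormalFunctional M ψ) :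
    ∃ ξ η : lp (fun _ : ℕ ⊕ ℕ => K) 2, ∀ x : M.toStarSubalgebra,
      φ x - ψ x = ⟪ξ, amplify (ℕ ⊕ ℕ) (x : K →L[ℂ] K) η⟫_ℂ := by
  obtain ⟨ξ₁, η₁, h₁⟩ := hφ
  obtain ⟨ξ₂, η₂, h₂⟩ := hψ
  let ξ : lp (fun _ : ℕ ⊕ ℕ => K) 2 := ⟨_, memℓp_sumElim ξ₁ (-ξ₂)⟩
  let η : lp (fun _ : ℕ ⊕ ℕ => K) 2 := ⟨_, memℓp_sumElim η₁ η₂⟩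
  refine ⟨ξ, η, fun x => ?_⟩
  have hs := lp.summable_inner (𝕜 := ℂ) ξ (amplify (ℕ ⊕ ℕ) (x : K →L[ℂ] K) η)
  rw [h₁, h₂, lp.inner_eq_tsum, Summable.tsum_sum
    (hs.comp_injective Sum.inl_injective) (hs.comp_injective Sum.inr_injective),
    sub_eq_add_neg, ← tsum_neg]
  simp only [amplify_apply, ξ, η, Sum.elim_inl, Sum.elim_inr, lp.coeFn_neg, Pi.neg_apply,
    inner_neg_left]

theorem IsNormalFunctional.eq_of_eqOn {φ ψ : M.toStarSubalgebra → ℂ}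
    (hφ : IsNormalFunctional M φ) (hψ : IsNormalFunctional M ψ) {S : StarSubalgebra ℂ (K →L[ℂ] K)}
    (hSM : S ≤ M.toStarSubalgebra) (h : ∀ s (hs : s ∈ S), φ ⟨s, hSM hs⟩ = ψ ⟨s, hSM hs⟩)
    {x : M.toStarSubalgebra}
    (hx : (x : K →L[ℂ] K) ∈ vonNeumannClosure (S : Set (K →L[ℂ] K))) : φ x = ψ x := by
  obtain ⟨ξ, η, hsub⟩ := hφ.exists_sub_eq_inner_amplify hψ
  have hclosed : IsClosed {ζ | ⟪ξ, ζ⟫_ℂ = 0} := isClosed_eq (by fun_prop) continuous_const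
  rw [← sub_eq_zero, hsub]
  refine closure_minimal ?_ hclosed (amplify_mem_closure S hx η)
  rintro _ ⟨s, hs, rfl⟩
  exact (hsub ⟨s, hSM hs⟩).symm.trans (sub_eq_zero.2 (h s hs))

theorem IsNormalMap.eq_of_eqOn {S : Set (K →L[ℂ] K)}
    {α β : (vonNeumannClosure S).toStarSubalgebra →⋆ₐ[ℂ] (vonNeumannClosure S).toStarSubalgebra}
    (hα : IsNormalMap (vonNeumannClosure S) α) (hβ : IsNormalMap (vonNeumannClosure S) β)
    (h : ∀ s (hs : s ∈ S), α ⟨s, subset_vonNeumannClosure S hs⟩ =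
      β ⟨s, subset_vonNeumannClosure S hs⟩) : α = β := by
  let M := vonNeumannClosure S
  let E : StarSubalgebra ℂ (K →L[ℂ] K) := (StarAlgHom.equalizer α β).map M.toStarSubalgebra.subtype
  have hEM : E ≤ M.toStarSubalgebra := by
    rintro _ ⟨y, -, rfl⟩
    exact y.2
  have hE (y) (hy : y ∈ E) : α ⟨y, hEM hy⟩ = β ⟨y, hEM hy⟩ := by
    obtain ⟨y, hy, rfl⟩ := hy
    exact hy
  have hSE (s) (hs : s ∈ S) : s ∈ vonNeumannClosure (E : Set (K →L[ℂ] K)) :=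
    subset_vonNeumannClosure _ ⟨⟨s, subset_vonNeumannClosure S hs⟩, h s hs, rfl⟩
  ext x : 1
  refine Subtype.ext (ContinuousLinearMap.ext fun w => ext_inner_left ℂ fun v => ?_)
  exact (hα _ (isNormalFunctional_inner M v w)).eq_of_eqOn
    (hβ _ (isNormalFunctional_inner M v w)) hEM (fun y hy => by rw [hE y hy])
    (map_mem_of_mem_vonNeumannClosure (.refl ..) hSE x.2)

end NormalMaps

section Normalizer

variable {K : Type*} [NormedAddCommGroup K] [InnerProductSpace ℂ K] [CompleteSpace K]

/-- The group of unitaries `W` with `W M W* = M`. -/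
def normalizer (M : VonNeumannAlgebra K) : Subgroup (unitary (K →L[ℂ] K)) where
  carrier := {W | ∀ x, Unitary.conjStarAlgAut ℂ (K →L[ℂ] K) W x ∈ M ↔ x ∈ M}
  one_mem' x := by rw [map_one]; rfl
  mul_mem' {W₁ W₂} h₁ h₂ x := by rw [map_mul]; exact (h₁ _).trans (h₂ x)
  inv_mem' {W} h x := by
    rw [← h, ← Unitary.conjStarAlgAut_mul_apply, mul_inv_cancel, map_one]; rfl

/-- The automorphism `Ad W` of `M` given by a unitary `W` with `W M W* = M`. -/
def normalizerConj (M : VonNeumannAlgebra K) :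
    normalizer M →* (M.toStarSubalgebra ≃⋆ₐ[ℂ] M.toStarSubalgebra) where
  toFun W :=
    let φ := Unitary.conjStarAlgAut ℂ (K →L[ℂ] K) W
    { toFun x := ⟨φ x, (W.2 x).2 x.2⟩
      invFun x := ⟨φ.symm x, (W.2 _).1 <| by rw [φ.apply_symm_apply]; exact x.2⟩
      left_inv x := Subtype.ext (φ.symm_apply_apply x)
      right_inv x := Subtype.ext (φ.apply_symm_apply x)
      map_mul' x y := Subtype.ext (map_mul φ (x : K →L[ℂ] K) y)
      map_add' x y := Subtype.ext (map_add φ (x : K →L[ℂ] K) y)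
      map_star' x := Subtype.ext (φ.map_star' x)
      map_smul' r x := Subtype.ext (map_smul φ r (x : K →L[ℂ] K)) }
  map_one' := by
    ext x : 2
    simp
  map_mul' W₁ W₂ := by
    ext x : 2
    exact Unitary.conjStarAlgAut_mul_apply _ _ _

theorem isNormalMap_normalizerConj {M : VonNeumannAlgebra K} (W : normalizer M) :
    IsNormalMap M (normalizerConj M W) := by
  intro φ hφ
  obtain ⟨ξ, η, hφ⟩ := isNormalFunctional_iff_inner_amplify.1 hφ
  refine isNormalFunctional_iff_inner_amplify.2
    ⟨amplify ℕ (star W.1.1) ξ, amplify ℕ (star W.1.1) η, fun x => ?_⟩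
  rw [hφ, ← star_amplify, ContinuousLinearMap.star_eq_adjoint (amplify ℕ W.1.1),
    ContinuousLinearMap.adjoint_inner_left, ← ContinuousLinearMap.star_eq_adjoint, star_amplify]
  rfl

theorem mem_normalizer_vonNeumannClosure {S : Set (K →L[ℂ] K)} {W : unitary (K →L[ℂ] K)}
    (h : ∀ s ∈ S, Unitary.conjStarAlgAut ℂ (K →L[ℂ] K) W s ∈ vonNeumannClosure S)
    (h_inv : ∀ s ∈ S, Unitary.conjStarAlgAut ℂ (K →L[ℂ] K) W⁻¹ s ∈ vonNeumannClosure S) :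
    W ∈ normalizer (vonNeumannClosure S) := by
  refine fun x => ⟨fun hx => ?_, map_mem_of_mem_vonNeumannClosure _ h⟩
  have := map_mem_of_mem_vonNeumannClosure _ h_inv hx
  rwa [← Unitary.conjStarAlgAut_mul_apply, inv_mul_cancel, map_one] at this

end Normalizer

section StrongConvergence

variable {K : Type*} [NormedAddCommGroup K] [InnerProductSpace ℂ K] [CompleteSpace K]
  {α : Type*} {l : Filter α}

theorem tendsto_unitary_apply_self_of_dense {u : α → unitary (K →L[ℂ] K)} {s : Set K}
    (hs : Dense (Submodule.span ℂ s : Set K))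
    (h : ∀ v ∈ s, Tendsto (fun a => (u a).1 v) l (𝓝 v)) (v : K) :
    Tendsto (fun a => (u a).1 v) l (𝓝 v) := by
  have hequi : UniformEquicontinuous fun a => ((u a).1 : K → K) :=
    LipschitzWith.uniformEquicontinuous _ 1 fun a =>
      (u a).1.lipschitz.weaken (norm_coe_unitary_le_one (u a))
  have hclosed := hequi.equicontinuous.isClosed_setOfPred_tendsto (l := l) continuous_id
  refine closure_minimal (fun w hw => ?_) hclosed (hs v)
  induction hw using Submodule.span_induction with
  | mem w hw => exact h w hw
  | zero => simpa using tendsto_const_nhds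
  | add w₁ w₂ _ _ h₁ h₂ => simpa using Tendsto.add h₁ h₂
  | smul c w _ hw => simpa using Tendsto.const_smul hw c

theorem tendsto_unitary_apply_self_of_inner {u : α → unitary (K →L[ℂ] K)} {v : K}
    (h : Tendsto (fun a => ⟪v, (u a).1 v⟫_ℂ) l (𝓝 ⟪v, v⟫_ℂ)) :
    Tendsto (fun a => (u a).1 v) l (𝓝 v) := by
  rw [tendsto_iff_norm_sub_tendsto_zero]
  have h_sq (a : α) : ‖(u a).1 v - v‖ ^ 2 = 2 * ‖v‖ ^ 2 - 2 * (⟪v, (u a).1 v⟫_ℂ).re := by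
    rw [norm_sub_sq (𝕜 := ℂ), Unitary.norm_map, inner_re_symm, RCLike.re_eq_complex_re]
    ring
  have hlim := ((Complex.continuous_re.tendsto _).comp h).const_mul 2 |>.const_sub (2 * ‖v‖ ^ 2)
  rw [show 2 * ‖v‖ ^ 2 - 2 * (⟪v, v⟫_ℂ).re = 0 by
    rw [← RCLike.re_eq_complex_re, inner_self_eq_norm_sq]; ring] at hlim
  simpa [← h_sq, Real.sqrt_sq] using hlim.sqrt

variable {κ : Type*}

omit [CompleteSpace K] in
theorem dense_span_lp_single [DecidableEq κ] :
    Dense (Submodule.span ℂ (Set.range fun p : κ × K =>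
      (lp.single 2 p.1 p.2 : lp (fun _ : κ => K) 2)) : Set (lp (fun _ : κ => K) 2)) := fun ξ =>
  mem_closure_of_tendsto (lp.hasSum_single (by simp) ξ) <| .of_forall fun _ =>
    Submodule.sum_mem _ fun k _ => Submodule.subset_span ⟨(k, ξ k), rfl⟩

theorem tendsto_diagUnitary_apply_self {c : α → κ → unitary (K →L[ℂ] K)}
    (h : ∀ k v, Tendsto (fun a => (c a k).1 v) l (𝓝 v)) (ξ : lp (fun _ : κ => K) 2) :
    Tendsto (fun a => (diagUnitary (c a)).1 ξ) l (𝓝 ξ) := by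
  classical
  refine tendsto_unitary_apply_self_of_dense (K := lp (fun _ : κ => K) 2)
    dense_span_lp_single ?_ ξ
  rintro _ ⟨⟨k, v⟩, rfl⟩
  simp only [diagUnitary_single]
  exact ((lp.singleContinuousLinearMap ℂ (fun _ : κ => K) 2 k).continuous.tendsto v).comp (h k v)

end StrongConvergence

section TensorProduct

variable {E F : Type*} [NormedAddCommGroup E] [InnerProductSpace ℂ E]
  [NormedAddCommGroup F] [InnerProductSpace ℂ F]

theorem dense_span_tmul :
    Dense (Submodule.span ℂ (Set.range fun p : E × F => ((p.1 ⊗ₜ[ℂ] p.2 : E ⊗[ℂ] F) :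
      HilbertTensor E F)) : Set (HilbertTensor E F)) := by
  refine UniformSpace.Completion.denseRange_coe.mono ?_
  rintro _ ⟨w, rfl⟩
  induction w using TensorProduct.induction_on with
  | zero => exact zero_mem _
  | tmul x y => exact Submodule.subset_span ⟨(x, y), rfl⟩
  | add w₁ w₂ h₁ h₂ => rw [UniformSpace.Completion.coe_add]; exact add_mem h₁ h₂

variable [CompleteSpace E] [CompleteSpace F]

/-- The homomorphism `u ↦ u ⊗ 1` of unitary groups. -/
def tensorOne (F : Type*) [NormedAddCommGroup F] [InnerProductSpace ℂ F] [CompleteSpace F] :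
    unitary (E →L[ℂ] E) →* unitary (HilbertTensor E F →L[ℂ] HilbertTensor E F) :=
  tensorRep (MonoidHom.id _) 1

theorem conj_tensorRep_opTensor_one {Γ : Type*} [Group Γ] (U : Γ →* unitary (E →L[ℂ] E))
    (V : Γ →* unitary (F →L[ℂ] F)) (g : Γ) (x : E →L[ℂ] E) :
    conj (tensorRep U V) g (opTensor x 1) = opTensor (conj U g x) 1 := by
  simp [conj, tensorRep, opTensor_star, ← opTensor_mul]

theorem commute_opTensor_one {M : VonNeumannAlgebra E} {N : VonNeumannAlgebra F} {u : E →L[ℂ] E}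
    (hu : ∀ d ∈ M, Commute u d) {x : HilbertTensor E F →L[ℂ] HilbertTensor E F}
    (hx : x ∈ vonNeumannTensor M N) : Commute (opTensor u 1) x := by
  have commute_opTensor {d : E →L[ℂ] E} (hd : d ∈ M) (y : F →L[ℂ] F) :
      Commute (opTensor d y) (opTensor u 1) := by
    rw [Commute, SemiconjBy, ← opTensor_mul, ← opTensor_mul, hu d hd, mul_one, one_mul]
  refine (commute_of_mem_vonNeumannClosure ?_ ?_ hx).symm
  · rintro _ ⟨d, hd, y, -, rfl⟩
    exact commute_opTensor hd y
  · rintro _ ⟨d, hd, y, -, rfl⟩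
    rw [opTensor_star]
    exact commute_opTensor (star_mem hd) _

theorem tendsto_tensorOne_apply_self {α : Type*} {l : Filter α} {u : α → unitary (E →L[ℂ] E)}
    (h : ∀ x, Tendsto (fun a => (u a).1 x) l (𝓝 x)) (v : HilbertTensor E F) :
    Tendsto (fun a => (tensorOne F (u a)).1 v) l (𝓝 v) := by
  refine tendsto_unitary_apply_self_of_dense dense_span_tmul ?_ v
  rintro _ ⟨⟨x, y⟩, rfl⟩
  have hcont : Continuous fun x : E => ((x ⊗ₜ[ℂ] y : E ⊗[ℂ] F) : HilbertTensor E F) :=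
    UniformSpace.Completion.continuous_coe _ |>.comp <|
      TensorProduct.continuous_tmul.comp (by fun_prop : Continuous fun x => (x, y))
  refine ((hcont.tendsto x).comp (h x)).congr fun a => ?_
  exact (opTensor_tmul _ 1 x y).symm

end TensorProduct

section CrossedProduct

variable {Γ : Type*} [Group Γ] {K : Type*} [NormedAddCommGroup K] [InnerProductSpace ℂ K]
  [CompleteSpace K] (U : Γ →* unitary (K →L[ℂ] K)) (N : VonNeumannAlgebra K)

variable {U N} in
theorem IsNormalMap.eq_of_crossedIncl_of_crossedUnitary
    {α β : (crossedProduct U N).toStarSubalgebra →⋆ₐ[ℂ] (crossedProduct U N).toStarSubalgebra}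
    (hα : IsNormalMap (crossedProduct U N) α) (hβ : IsNormalMap (crossedProduct U N) β)
    (h_incl : ∀ x, α (crossedIncl U N x) = β (crossedIncl U N x))
    (h_unitary : ∀ g, α (crossedUnitary U N g) = β (crossedUnitary U N g)) : α = β := by
  refine IsNormalMap.eq_of_eqOn hα hβ ?_
  rintro _ (⟨x, hx, rfl⟩ | ⟨g, rfl⟩)
  · exact h_incl ⟨x, hx⟩
  · exact h_unitary g

variable {U N} in
theorem conj_mem_of_map_mul {c : Γ → unitary (K →L[ℂ] K)} (h_mem : ∀ g, (c g).1 ∈ N)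
    (h_mul : ∀ g h, c (g * h) = c g * MulAut.conj (U g) (c h)) (g h : Γ) :
    (MulAut.conj (U g) (c h)).1 ∈ N := by
  have : MulAut.conj (U g) (c h) = (c g)⁻¹ * c (g * h) := by rw [h_mul, inv_mul_cancel_left]
  rw [this]
  exact mul_mem (star_mem (h_mem g)) (h_mem (g * h))

/-- The group of unitary 1-cocycles `c` for the action `σ_g = Ad U_g` on `N`, that is
`c_{gh} = c_g σ_g(c_h)`, with values in the center of `N`. -/
def centralCocycles : Subgroup (Γ → unitary (K →L[ℂ] K)) where
  carrier := {c | (∀ g, (c g).1 ∈ N) ∧ (∀ g, ∀ x ∈ N, Commute (c g).1 x) ∧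
    ∀ g h, c (g * h) = c g * MulAut.conj (U g) (c h)}
  one_mem' := ⟨fun _ => one_mem N, fun _ x _ => Commute.one_left x, fun g h => by simp⟩
  mul_mem' {c d} hc hd := by
    refine ⟨fun g => mul_mem (hc.1 g) (hd.1 g),
      fun g x hx => (hc.2.1 g x hx).mul_left (hd.2.1 g x hx), fun g h => ?_⟩
    have hcomm : d g * MulAut.conj (U g) (c h) = MulAut.conj (U g) (c h) * d g :=
      Subtype.ext (hd.2.1 g _ (conj_mem_of_map_mul hc.1 hc.2.2 g h))
    simp only [Pi.mul_apply, hc.2.2 g h, hd.2.2 g h, map_mul, mul_assoc]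
    rw [← mul_assoc (d g), hcomm, mul_assoc]
  inv_mem' {c} hc := by
    refine ⟨fun g => star_mem (hc.1 g), fun g x hx => ?_, fun g h => ?_⟩
    · have h_star := (hc.2.1 g (star x) (star_mem hx)).star_star
      rwa [star_star] at h_star
    have hcomm : c g * MulAut.conj (U g) (c h) = MulAut.conj (U g) (c h) * c g :=
      Subtype.ext (hc.2.1 g _ (conj_mem_of_map_mul hc.1 hc.2.2 g h))
    rw [Pi.inv_apply, hc.2.2 g h, hcomm, mul_inv_rev, Pi.inv_apply, Pi.inv_apply, map_inv]

variable {U N}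

/-- The unitary cocycles `g ↦ p(t b(g))`, with additive parameter `t`, obtained from a
`Γ`-equivariant representation `p` of the additive group of a linear `Γ`-representation `(H, π)` and
a 1-cocycle `b` with values in `H`. -/
def centralCocyclesOfAddChar {R H : Type*} [CommRing R] [AddCommGroup H] [Module R H]
    {π : Γ → H →ₗ[R] H} {b : Γ → H} (hb : ∀ g h, b (g * h) = π g (b h) + b g)
    {p : AddChar H (unitary (K →L[ℂ] K))} (hp_mem : ∀ ξ, (p ξ).1 ∈ N)
    (hp_comm : ∀ ξ, ∀ x ∈ N, Commute (p ξ).1 x)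
    (hp_conj : ∀ g ξ, conj U g (p ξ).1 = (p (π g ξ)).1) :
    AddChar R (centralCocycles U N) where
  toFun t := ⟨fun g => p (t • b g), fun g => hp_mem _, fun g => hp_comm _, fun g h => calc
    p (t • b (g * h)) = p (t • b g) * p (π g (t • b h)) := by
      rw [← AddChar.map_add_eq_mul, hb, smul_add, add_comm, map_smul]
    _ = p (t • b g) * MulAut.conj (U g) (p (t • b h)) :=
      congrArg _ (Subtype.ext (hp_conj g _).symm)⟩
  map_zero_eq_one' := Subtype.ext <| funext fun g => by
    simp only [zero_smul, AddChar.map_zero_eq_one]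
    rfl
  map_add_eq_mul' s t := Subtype.ext <| funext fun g => by
    simp only [add_smul, AddChar.map_add_eq_mul]
    rfl

variable {c : Γ → unitary (K →L[ℂ] K)}

variable (U) in
/-- The diagonal unitary on `ℓ²(Γ, K)` with entries `σ_{h⁻¹}(c_h)`. When `c` is a cocycle, the
`h`-th entry is also `c_{h⁻¹}*`. -/
def cocycleUnitary : (Γ → unitary (K →L[ℂ] K)) →*
    unitary (lp (fun _ : Γ => K) 2 →L[ℂ] lp (fun _ : Γ => K) 2) where
  toFun c := diagUnitary fun h => MulAut.conj (U h⁻¹) (c h)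
  map_one' := by simp only [Pi.one_apply, map_one]; exact map_one _
  map_mul' c d := by simp only [Pi.mul_apply, map_mul]; exact map_mul diagUnitary _ _

theorem cocycleUnitary_single_one [DecidableEq Γ] (c : Γ → unitary (K →L[ℂ] K)) (v : K) :
    (cocycleUnitary U c).1 (lp.single 2 1 v) = lp.single 2 1 ((c 1).1 v) := by
  refine (diagUnitary_single _ 1 v).trans ?_
  rw [inv_one, map_one, map_one, MulAut.one_apply]

theorem conj_cocycleUnitary_crossedRep (c : Γ → unitary (K →L[ℂ] K)) {x : K →L[ℂ] K}
    (h : ∀ g, Commute (c g).1 x) :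
    Unitary.conjStarAlgAut ℂ _ (cocycleUnitary U c) (crossedRep U x) = crossedRep U x := by
  have hcomm : (cocycleUnitary U c).1 * crossedRep U x =
      crossedRep U x * (cocycleUnitary U c).1 := by
    ext ξ g
    exact congr($((h g).map (Unitary.conjStarAlgAut ℂ (K →L[ℂ] K) (U g⁻¹))) (ξ g))
  rw [Unitary.conjStarAlgAut_apply, hcomm, mul_assoc,
    Unitary.mul_star_self_of_mem (cocycleUnitary U c).2, mul_one]

theorem conj_cocycleUnitary_leftShift
    (hc : ∀ g h, c (g * h) = c g * MulAut.conj (U g) (c h)) (g : Γ) :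
    Unitary.conjStarAlgAut ℂ _ (cocycleUnitary U c) (leftShift g) =
      crossedRep U (c g).1 * leftShift g := by
  have hentry (h : Γ) : MulAut.conj (U h⁻¹) (c h) =
      MulAut.conj (U h⁻¹) (c g) * MulAut.conj (U (g⁻¹ * h)⁻¹) (c (g⁻¹ * h)) := by
    calc MulAut.conj (U h⁻¹) (c h)
        = MulAut.conj (U h⁻¹) (c g * MulAut.conj (U g) (c (g⁻¹ * h))) := by
          rw [← hc, mul_inv_cancel_left]
      _ = _ := by
          rw [map_mul, ← MulAut.mul_apply, ← map_mul, ← map_mul, mul_inv_rev, inv_inv]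
  have hshift : (cocycleUnitary U c).1 * leftShift g =
      crossedRep U (c g).1 * leftShift g * (cocycleUnitary U c).1 := by
    ext ξ h
    exact congr(($(hentry h)).1 (ξ (g⁻¹ * h)))
  rw [Unitary.conjStarAlgAut_apply, hshift, mul_assoc,
    Unitary.mul_star_self_of_mem (cocycleUnitary U c).2, mul_one]

theorem cocycleUnitary_mem_normalizer (hc : c ∈ centralCocycles U N) :
    cocycleUnitary U c ∈ normalizer (crossedProduct U N) := by
  have conj_mem {c : Γ → unitary (K →L[ℂ] K)} (hc : c ∈ centralCocycles U N)
      (s : lp (fun _ : Γ => K) 2 →L[ℂ] lp (fun _ : Γ => K) 2)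
      (hs : s ∈ {z | ∃ x ∈ N, z = crossedRep U x} ∪ Set.range leftShift) :
      Unitary.conjStarAlgAut ℂ _ (cocycleUnitary U c) s ∈ crossedProduct U N := by
    rcases hs with ⟨x, hx, rfl⟩ | ⟨g, rfl⟩
    · rw [conj_cocycleUnitary_crossedRep c fun g => hc.2.1 g x hx]
      exact (crossedIncl U N ⟨x, hx⟩).2
    · rw [conj_cocycleUnitary_leftShift hc.2.2]
      exact mul_mem (crossedIncl U N ⟨(c g).1, hc.1 g⟩).2 (crossedUnitary U N g).2
  refine mem_normalizer_vonNeumannClosure (conj_mem hc) fun s hs => ?_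
  rw [← map_inv]
  exact conj_mem (inv_mem hc) s hs

variable (U N) in
/-- The automorphism of `N ⋊ Γ` that fixes `N` and maps `u_g` to `c_g u_g`. -/
def crossedAut : centralCocycles U N →* ((crossedProduct U N).toStarSubalgebra ≃⋆ₐ[ℂ]
    (crossedProduct U N).toStarSubalgebra) :=
  (normalizerConj _).comp <| ((cocycleUnitary U).comp (centralCocycles U N).subtype).codRestrict _
    fun c => cocycleUnitary_mem_normalizer c.2

theorem isNormalMap_crossedAut (c : centralCocycles U N) :
    IsNormalMap (crossedProduct U N) (crossedAut U N c) := isNormalMap_normalizerConj _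

theorem crossedAut_crossedIncl (c : centralCocycles U N) (x : N.toStarSubalgebra) :
    crossedAut U N c (crossedIncl U N x) = crossedIncl U N x :=
  Subtype.ext (conj_cocycleUnitary_crossedRep c.1 fun g => c.2.2.1 g x x.2)

theorem crossedAut_crossedUnitary (c : centralCocycles U N) (g : Γ) :
    crossedAut U N c (crossedUnitary U N g) =
      crossedIncl U N ⟨(c.1 g).1, c.2.1 g⟩ * crossedUnitary U N g :=
  Subtype.ext (conj_cocycleUnitary_leftShift c.2.2.2 g)

theorem crossedAut_addChar_zero_apply {R : Type*} [AddMonoid R]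
    (c : AddChar R (centralCocycles U N)) (x : (crossedProduct U N).toStarSubalgebra) :
    crossedAut U N (c 0) x = x :=
  congr($((congrArg (crossedAut U N) c.map_zero_eq_one).trans (map_one _)) x)

theorem crossedAut_addChar_add_apply {R : Type*} [AddMonoid R]
    (c : AddChar R (centralCocycles U N)) (s t : R) (x : (crossedProduct U N).toStarSubalgebra) :
    crossedAut U N (c (s + t)) x = crossedAut U N (c s) (crossedAut U N (c t) x) :=
  congr($((congrArg (crossedAut U N) (c.map_add_eq_mul s t)).trans (map_mul _ _ _)) x)

theorem crossedAut_apply_single_one [DecidableEq Γ] (c : centralCocycles U N)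
    (x : (crossedProduct U N).toStarSubalgebra) (v : K) :
    (crossedAut U N c x).1 (lp.single 2 1 v) =
      (cocycleUnitary U c.1).1 (x.1 (lp.single 2 1 v)) := by
  have map_one : c.1⁻¹ 1 = 1 := by
    simpa using (inv_mem c.2).2.2 1 1
  have hfix : (cocycleUnitary U c.1⁻¹).1 (lp.single 2 1 v) = lp.single 2 1 v := by
    rw [cocycleUnitary_single_one, map_one]; rfl
  rw [map_inv] at hfix
  exact congr((cocycleUnitary U c.1).1 (x.1 $hfix))

theorem sqrt_inner_star_mul_self_apply (A : K →L[ℂ] K) (v : K) :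
    √(⟪v, (star A * A) v⟫_ℂ).re = ‖A v‖ := by
  rw [mul_apply_eq_comp, ContinuousLinearMap.star_eq_adjoint,
    ContinuousLinearMap.adjoint_inner_right, ← RCLike.re_eq_complex_re, inner_self_eq_norm_sq,
    Real.sqrt_sq (norm_nonneg _)]

theorem tendsto_crossedAut_apply_single_one [DecidableEq Γ] {α : Type*} {l : Filter α}
    {c : α → centralCocycles U N}
    (hc : ∀ g v, Tendsto (fun a => ((c a).1 g).1 v) l (𝓝 v))
    (x : (crossedProduct U N).toStarSubalgebra) (v : K) :
    Tendsto (fun a => (crossedAut U N (c a) x).1 (lp.single 2 1 v)) l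
      (𝓝 (x.1 (lp.single 2 1 v))) := by
  simp only [crossedAut_apply_single_one]
  refine tendsto_diagUnitary_apply_self (fun h w => ?_) _
  have hw := (((U h⁻¹).1.continuous.tendsto _).comp (hc h ((U h⁻¹)⁻¹.1 w)))
  rwa [show (U h⁻¹).1 ((U h⁻¹)⁻¹.1 w) = w from
    congr($(Unitary.coe_mul_star_self (U h⁻¹)) w)] at hw

theorem tendsto_sqrt_inner_crossedAut_sub [DecidableEq Γ] {α : Type*} {l : Filter α}
    {c : α → centralCocycles U N}
    (hc : ∀ g v, Tendsto (fun a => ((c a).1 g).1 v) l (𝓝 v))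
    (x : (crossedProduct U N).toStarSubalgebra) (v : K) :
    Tendsto (fun a => √(⟪lp.single 2 1 v, (star (crossedAut U N (c a) x - x) *
      (crossedAut U N (c a) x - x)).1 (lp.single 2 1 v)⟫_ℂ).re) l (𝓝 0) :=
  (tendsto_iff_norm_sub_tendsto_zero.1 (tendsto_crossedAut_apply_single_one hc x v)).congr
    fun _ => (sqrt_inner_star_mul_self_apply _ _).symm

end CrossedProduct

section MultiplicationOperators

variable {Z : Type*} [MeasurableSpace Z] {ν : Measure Z} {f g h : Lp ℂ ∞ ν}

theorem mulOp_eq_mul_of_ae_eq (hfgh : f =ᵐ[ν] fun z => g z * h z) :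
    mulOp ν f = mulOp ν g * mulOp ν h := by
  ext1 ψ
  refine Lp.ext ?_
  filter_upwards [mulOp_apply ν f ψ, hfgh, mulOp_apply ν g (mulOp ν h ψ), mulOp_apply ν h ψ]
    with z h₁ h₂ h₃ h₄
  rw [h₁, h₂, mul_apply_eq_comp, h₃, h₄, mul_assoc]

theorem star_mulOp (f : Lp ℂ ∞ ν) : star (mulOp ν f) = mulOp ν (star f) := by
  rw [ContinuousLinearMap.star_eq_adjoint, eq_comm, ContinuousLinearMap.eq_adjoint_iff]
  intro ψ φ
  rw [L2.inner_def, L2.inner_def]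
  refine integral_congr_ae ?_
  filter_upwards [mulOp_apply ν (star f) ψ, Lp.coeFn_star f, mulOp_apply ν f φ] with z h₁ h₂ h₃
  rw [h₁, h₂, h₃]
  simp [mul_left_comm, mul_assoc]

theorem commute_mulOp (f g : Lp ℂ ∞ ν) : Commute (mulOp ν f) (mulOp ν g) := by
  ext1 ψ
  refine Lp.ext ?_
  filter_upwards [mulOp_apply ν f (mulOp ν g ψ), mulOp_apply ν g ψ,
    mulOp_apply ν g (mulOp ν f ψ), mulOp_apply ν f ψ] with z h₁ h₂ h₃ h₄
  rw [mul_apply_eq_comp, mul_apply_eq_comp,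
    h₁, h₂, h₃, h₄, mul_left_comm]

theorem mulOp_mem_unitary (hf : ∀ᵐ z ∂ν, ‖f z‖ = 1) : mulOp ν f ∈ unitary _ := by
  have h_star_mul : star (mulOp ν f) * mulOp ν f = 1 := by
    rw [star_mulOp]
    ext1 ψ
    refine Lp.ext ?_
    filter_upwards [mulOp_apply ν (star f) (mulOp ν f ψ), mulOp_apply ν f ψ, Lp.coeFn_star f, hf]
      with z h₁ h₂ h₃ h₄
    rw [mul_apply_eq_comp, h₁, h₂, h₃, ← mul_assoc, Pi.star_apply,
      RCLike.star_def, RCLike.conj_mul, h₄]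
    simp
  refine Unitary.mem_iff.2 ⟨h_star_mul, ?_⟩
  rw [← h_star_mul, star_mulOp]
  exact commute_mulOp _ _

theorem dense_span_mulOp_one [IsFiniteMeasure ν] :
    Dense (Submodule.span ℂ (Set.range fun f : Lp ℂ ∞ ν => mulOp ν f (Lp.const 2 ν 1)) :
      Set (Lp ℂ 2 ν)) := by
  intro ψ
  induction ψ using Lp.induction (p := 2) ENNReal.ofNat_ne_top with
  | isClosed => exact isClosed_closure
  | add _ _ _ hf hg => exact (Submodule.span ℂ _).topologicalClosure.add_mem hf hg
  | indicatorConst c hs hμs =>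
    refine subset_closure (Submodule.subset_span ⟨indicatorConstLp ∞ hs hμs.ne c, ?_⟩)
    refine Lp.ext ?_
    filter_upwards [mulOp_apply ν (indicatorConstLp ∞ hs hμs.ne c) (Lp.const 2 ν 1),
      Lp.coeFn_const (p := 2) (μ := ν) (1 : ℂ), indicatorConstLp_coeFn (p := ∞) (hs := hs)
        (hμs := hμs.ne) (c := c), indicatorConstLp_coeFn (p := 2) (hs := hs)
        (hμs := hμs.ne) (c := c)] with z h₁ h₂ h₃ h₄
    rw [h₁, h₂, h₃, Function.const_apply, mul_one, ← h₄]
    rfl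

end MultiplicationOperators

section Omega

variable {ι : Type*} {H : Type*} [NormedAddCommGroup H] [InnerProductSpace ℝ H]
  (e : HilbertBasis ι ℝ H)

theorem norm_omega (ξ : H) : ∀ᵐ z ∂gaussianProduct ι, ‖omega e ξ z‖ = 1 := by
  filter_upwards [(memLp_omega e ξ).coeFn_toLp] with z hz
  have h_exponent : (√2 * Complex.I * gaussianField e ξ z : ℂ) =
      ((√2 * gaussianField e ξ z : ℝ) : ℂ) * Complex.I := by
    push_cast; ring
  rw [omega, hz, h_exponent, Complex.norm_exp_ofReal_mul_I]

/-- The unitary representation `ξ ↦ ω(ξ)` of the additive group of `H` on `L²(Z, ν)`. -/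
def omegaRep : AddChar H
    (unitary (Lp ℂ 2 (gaussianProduct ι) →L[ℂ] Lp ℂ 2 (gaussianProduct ι))) where
  toFun ξ := ⟨mulOp (gaussianProduct ι) (omega e ξ), mulOp_mem_unitary (norm_omega e ξ)⟩
  map_zero_eq_one' := by
    have h_idem := mulOp_eq_mul_of_ae_eq (omega_add e (0 : H) 0)
    rw [add_zero] at h_idem
    exact left_eq_mul.1 (Subtype.ext h_idem :
      (⟨_, mulOp_mem_unitary (norm_omega e (0 : H))⟩ : unitary _) = ⟨_, _⟩ * ⟨_, _⟩)
  map_add_eq_mul' ξ η := Subtype.ext (mulOp_eq_mul_of_ae_eq (omega_add e ξ η))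

theorem inner_one_omegaRep (ξ : H) :
    ⟪Lp.const 2 (gaussianProduct ι) (1 : ℂ), (omegaRep e ξ).1 (Lp.const 2 _ 1)⟫_ℂ =
      Complex.exp (-(‖ξ‖ ^ 2 : ℝ)) := by
  rw [← integral_omega e ξ, L2.inner_def]
  refine integral_congr_ae ?_
  filter_upwards [mulOp_apply (gaussianProduct ι) (omega e ξ) (Lp.const 2 _ 1),
    Lp.coeFn_const (p := 2) (μ := gaussianProduct ι) (1 : ℂ)] with z h₁ h₂
  rw [h₂]
  refine (congrArg _ h₁).trans ?_
  simp

theorem tendsto_omegaRep_apply_self {α : Type*} {l : Filter α} {ξ : α → H}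
    (hξ : Tendsto ξ l (𝓝 0)) (ψ : Lp ℂ 2 (gaussianProduct ι)) :
    Tendsto (fun a => (omegaRep e (ξ a)).1 ψ) l (𝓝 ψ) := by
  have h_one : Tendsto (fun a => (omegaRep e (ξ a)).1 (Lp.const 2 _ 1)) l (𝓝 (Lp.const 2 _ 1)) := by
    refine tendsto_unitary_apply_self_of_inner ?_
    have h_exp : Continuous fun ξ : H => Complex.exp (-(‖ξ‖ ^ 2 : ℝ)) := by fun_prop
    have h_zero := inner_one_omegaRep e (0 : H)
    rw [AddChar.map_zero_eq_one, OneMemClass.coe_one, one_apply_eq_self] at h_zero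
    simp only [inner_one_omegaRep]
    rw [h_zero]
    exact (h_exp.tendsto 0).comp hξ
  refine tendsto_unitary_apply_self_of_dense dense_span_mulOp_one ?_ ψ
  rintro _ ⟨f, rfl⟩
  refine (((mulOp _ f).continuous.tendsto _).comp h_one).congr fun a => ?_
  exact congr($((commute_mulOp f (omega e (ξ a))).eq) (Lp.const 2 _ 1))

end Omega

section Deformation

variable {Γ : Type*} [Group Γ] {X : Type*} [MeasurableSpace X] (μ : Measure X)
  {ι : Type*} {H : Type*} [NormedAddCommGroup H] [InnerProductSpace ℝ H]
  (e : HilbertBasis ι ℝ H)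

/-- The unitary representation `ξ ↦ ω(ξ) ⊗ 1` of the additive group of `H`. -/
def phase : AddChar H (unitary (HilbertTensor (Lp ℂ 2 (gaussianProduct ι)) (Lp ℂ 2 μ) →L[ℂ]
    HilbertTensor (Lp ℂ 2 (gaussianProduct ι)) (Lp ℂ 2 μ))) :=
  (tensorOne (Lp ℂ 2 μ)).compAddChar (omegaRep e)

theorem tendsto_phase_apply_self {α : Type*} {l : Filter α} {ξ : α → H} (hξ : Tendsto ξ l (𝓝 0))
    (v : HilbertTensor (Lp ℂ 2 (gaussianProduct ι)) (Lp ℂ 2 μ)) :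
    Tendsto (fun a => (phase μ e (ξ a)).1 v) l (𝓝 v) :=
  tendsto_tensorOne_apply_self (tendsto_omegaRep_apply_self e hξ) v

variable {μ e} in
theorem commute_phase_of_mem_baseAlgebra (ξ : H)
    {x : HilbertTensor (Lp ℂ 2 (gaussianProduct ι)) (Lp ℂ 2 μ) →L[ℂ]
      HilbertTensor (Lp ℂ 2 (gaussianProduct ι)) (Lp ℂ 2 μ)} (hx : x ∈ baseAlgebra μ e) :
    Commute (phase μ e ξ).1 x := by
  refine commute_opTensor_one (fun d hd => ?_) hx
  refine (commute_of_mem_vonNeumannClosure ?_ ?_ hd).symm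
  · rintro _ ⟨η, rfl⟩
    exact commute_mulOp _ _
  · rintro _ ⟨η, rfl⟩
    rw [star_mulOp]
    exact commute_mulOp _ _

variable [MulAction Γ X] [MeasurableConstSMul Γ X] [SMulInvariantMeasure Γ X μ]
  [Countable ι] (π : Γ →* (H ≃ₗᵢ[ℝ] H))

theorem conj_diagonalRep_phase (g : Γ) (ξ : H) :
    conj (diagonalRep μ e π) g (phase μ e ξ).1 = (phase μ e (π g ξ)).1 :=
  (conj_tensorRep_opTensor_one (gaussianRep e π) (actionRep μ) g _).trans
    congr(opTensor $(conj_gaussianRep_omega e π g ξ) 1)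

variable {b : Γ → H} (hb : ∀ g h : Γ, b (g * h) = π g (b h) + b g)

/-- The one-parameter group of unitary cocycles `g ↦ ω(t b(g)) ⊗ 1` for the diagonal action on
`D ⊗̄ A`. -/
def phaseCocycle : AddChar ℝ (centralCocycles (diagonalRep μ e π) (baseAlgebra μ e)) :=
  centralCocyclesOfAddChar (p := phase μ e) (π := fun g => (π g).toLinearEquiv.toLinearMap) hb
    (fun ξ => (omegaTensorOne μ e ξ).2) (fun ξ _ => commute_phase_of_mem_baseAlgebra ξ)
    (conj_diagonalRep_phase μ e π)

/-- The automorphism `α_t` of `M̃` that fixes `D ⊗̄ A` and maps `u_g` to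
`(ω(t b(g)) ⊗ 1) u_g`. -/
def deformation (t : ℝ) : TildeM μ e π ≃⋆ₐ[ℂ] TildeM μ e π :=
  crossedAut (diagonalRep μ e π) (baseAlgebra μ e) (phaseCocycle μ e π hb t)

theorem isDeformation_deformation (t : ℝ) :
    IsDeformation μ e π b t (deformation μ e π hb t) :=
  let c := phaseCocycle μ e π hb t
  ⟨isNormalMap_crossedAut c, crossedAut_crossedIncl c, crossedAut_crossedUnitary c⟩

variable {μ e π} in
theorem IsDeformation.unique {b : Γ → H} {t : ℝ} {α β : TildeM μ e π →⋆ₐ[ℂ] TildeM μ e π}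
    (hα : IsDeformation μ e π b t α) (hβ : IsDeformation μ e π b t β) : α = β :=
  IsNormalMap.eq_of_crossedIncl_of_crossedUnitary hα.1 hβ.1
    (fun x => (hα.2.1 x).trans (hβ.2.1 x).symm) fun g => (hα.2.2 g).trans (hβ.2.2 g).symm

theorem deformation_zero_apply (x : TildeM μ e π) : deformation μ e π hb 0 x = x :=
  crossedAut_addChar_zero_apply (phaseCocycle μ e π hb) x

theorem deformation_add_apply (s t : ℝ) (x : TildeM μ e π) :
    deformation μ e π hb (s + t) x = deformation μ e π hb s (deformation μ e π hb t x) :=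
  crossedAut_addChar_add_apply (phaseCocycle μ e π hb) s t x

theorem tendsto_twoNorm_deformation_sub [IsProbabilityMeasure μ] (x : TildeM μ e π) :
    Tendsto (fun t => twoNorm μ e π (deformation μ e π hb t x - x)) (𝓝 0) (𝓝 0) := by
  classical
  have h_smul (v : H) : Tendsto (fun t : ℝ => t • v) (𝓝 0) (𝓝 0) := by
    simpa using (tendsto_id (x := 𝓝 (0 : ℝ))).smul_const v
  exact tendsto_sqrt_inner_crossedAut_sub (c := phaseCocycle μ e π hb)
    (fun g => tendsto_phase_apply_self μ e (h_smul (b g))) x (baseVector μ)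

end Deformation

end CocycleDeformation
end

theorem proposition3p3 {Γ : Type*} [Group Γ]
    {X : Type*} [MeasurableSpace X] (μ : Measure X) [IsProbabilityMeasure μ]
    [MulAction Γ X] [MeasurableConstSMul Γ X] [SMulInvariantMeasure Γ X μ]
    {H : Type*} [NormedAddCommGroup H] [InnerProductSpace ℝ H]
    {ι : Type*} [Countable ι] (e : HilbertBasis ι ℝ H)
    (π : Γ →* (H ≃ₗᵢ[ℝ] H)) (b : Γ → H) (hb : ∀ g h : Γ, b (g * h) = π g (b h) + b g) :
    ∃ α : ℝ → (CocycleDeformation.TildeM μ e π ≃⋆ₐ[ℂ] CocycleDeformation.TildeM μ e π),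
      (∀ t : ℝ,
        CocycleDeformation.IsDeformation μ e π b t (α t) ∧
        ∀ β : CocycleDeformation.TildeM μ e π →⋆ₐ[ℂ] CocycleDeformation.TildeM μ e π,
          CocycleDeformation.IsDeformation μ e π b t β → ∀ x, β x = α t x) ∧
      (∀ x, α 0 x = x) ∧
      (∀ (s t : ℝ) (x : CocycleDeformation.TildeM μ e π), α (s + t) x = α s (α t x)) ∧
      ∀ x : CocycleDeformation.TildeM μ e π,
        Tendsto (fun t : ℝ => CocycleDeformation.twoNorm μ e π (α t x - x)) (𝓝 0) (𝓝 0) := by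
  have hα := CocycleDeformation.isDeformation_deformation μ e π hb
  refine ⟨CocycleDeformation.deformation μ e π hb, fun t => ⟨hα t, fun β hβ x => ?_⟩,
    CocycleDeformation.deformation_zero_apply μ e π hb,
    CocycleDeformation.deformation_add_apply μ e π hb,
    CocycleDeformation.tendsto_twoNorm_deformation_sub μ e π hb⟩
  have h_eq : β = (CocycleDeformation.deformation μ e π hb t).toStarAlgHom := hβ.unique (hα t)
  exact congr($h_eq x)
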